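/- **Rumor process.** Let $G=(V,E)$ be a finite simple graph, $N(v)$ the neighborhood of $v$, $\hat N(v)=N(v)\cup\{v\}$, and $S(v,w)=|\hat N(v)\cap\hat N(w)|/|N(v)\cup N(w)|$. Fix an integer $k\ge 1$. Every node is uncolored, red or orange, and all nodes update simultaneously in rounds $t=1,2,\dots$. Let $J_t(v)$ be the number of rounds $s<t$ in which $v$ was red. In round $t$ an orange node stays orange; a red node $v$ stays red if $J_t(v)<k$ and becomes orange if $J_t(v)=k$; an uncolored node $v$ stays uncolored with probability $\prod_{w}\bigl(1-S(v,w)/2^{J_t(w)}\bigr)$, where $w$ runs over the neighbors of $v$ that were red in round $t-1$, and becomes red otherwise, independently for different nodes given the past. Initially one node $v_0$ is red and all others are uncolored. **Moderate expanders.** Fix $C>0$. Let $L$ be $\log^2 n$ (natural logarithm) rounded down or up to an integer, $n=NL$, $D=dL$, and let $H$ be an $N$-node $D$-regular simple graph such that the second-largest absolute value (with multiplicity) of the eigenvalues of its adjacency matrix is at most $C\sqrt D$. Replace every node of $H$ by a clique of $L$ nodes, and every edge $xy$ of $H$ by one edge between the cliques of $x$ and $y$, so that every node receives exactly $d$ of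 these edges. Every $n$-node graph obtained in this way is called an $(n,d)$-moderate expander (with constant $C$). **Theorem.** Let $C>0$, an integer $k\ge1$ and $\alpha\in(0,1)$ (for instance $\alpha=1/10$) be constants. (a) There is a constant $K>0$ such that for every $d=d(n)$ with $d\to\infty$ and $d=O(\log^2 n)$ the following holds with probability $1-o(1)$ as $n\to\infty$, uniformly over all $(n,d)$-moderate expanders (with constant $C$) and all initial red nodes $v_0$: after $\lfloor K\log_d n\rfloor$ rounds at least $\alpha n$ nodes are orange. That is, the rumor spreads within $O(\log_d n)$ rounds with high probability. (b) The condition $d\to\infty$ is necessary: for every constant $d$ there is a $\delta>0$ such that for all sufficiently large $n$, every $(n,d)$-moderate expander (with constant $C$) and every initial red node $v_0$, with probability at least $\delta$ the number of orange nodes never reaches $\alpha n$. -/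

import Mathlib

noncomputable section

namespace RumorSpreading

/-! ### The rumor spreading model -/

/-- The three colors: uncolored (uninformed), red (informed), orange (uninterested). -/
inductive Color where
  | uncolored : Color
  | red : Color
  | orange : Color

variable {V : Type*}

/-- The closed neighborhood of a node. -/
def closedNbhd (G : SimpleGraph V) (v : V) : Set V := insert v (G.neighborSet v)

/-- The similarity `|N̂(v) ∩ N̂(w)| / |N(v) ∪ N(w)|`, used for adjacent nodes only. -/
def similarity (G : SimpleGraph V) (v w : V) : ℝ :=
  ((closedNbhd G v ∩ closedNbhd G w).ncard : ℝ) /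
    ((G.neighborSet v ∪ G.neighborSet w).ncard : ℝ)

/-- A configuration records, for every node, its color and the number of rounds in which it has
been red so far (the present one included).  For a node that is red in round `t - 1`, the recorded
number is the value `J_t` that is used in round `t`. -/
abbrev Config (V : Type*) := V → Color × ℕ

open Classical in
/-- The initial configuration: `v₀` is red, everything else is uncolored. -/
def initial (v₀ : V) : Config V :=
  fun v => if v = v₀ then (Color.red, 1) else (Color.uncolored, 0)

open Classical in
/-- The probability `p*(v)` that an uncolored node `v` is made red by none of its red neighbors. -/
def stayProb [Fintype V] (G : SimpleGraph V) (c : Config V) (v : V) : ℝ :=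
  ∏ w ∈ Finset.univ.filter (fun w => G.Adj v w ∧ (c w).1 = Color.red),
    (1 - similarity G v w / 2 ^ (c w).2)

lemma similarity_nonneg (G : SimpleGraph V) (v w : V) : 0 ≤ similarity G v w := by
  unfold similarity; positivity

lemma similarity_le_one [Fintype V] (G : SimpleGraph V) {v w : V} (h : G.Adj v w) :
    similarity G v w ≤ 1 := by
  unfold similarity
  apply div_le_one_of_le₀ _ (by positivity)
  norm_cast
  apply Set.ncard_le_ncard _ (Set.toFinite _)
  rintro x ⟨hx, hx'⟩
  rcases hx with rfl | hx
  · exact Or.inr h.symm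
  · exact Or.inl hx

lemma stayProb_mem [Fintype V] (G : SimpleGraph V) (c : Config V) (v : V) :
    0 ≤ stayProb G c v ∧ stayProb G c v ≤ 1 := by
  classical
  have key : ∀ w, G.Adj v w → similarity G v w / 2 ^ (c w).2 ≤ 1 := fun w h =>
    div_le_one_of_le₀ ((similarity_le_one G h).trans (one_le_pow₀ (by norm_num))) (by positivity)
  have key' : ∀ w, 0 ≤ similarity G v w / 2 ^ (c w).2 := fun w =>
    div_nonneg (similarity_nonneg G v w) (by positivity)
  unfold stayProb
  refine ⟨Finset.prod_nonneg fun w hw => ?_, Finset.prod_le_one (fun w hw => ?_) fun w hw => ?_⟩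
  · have := key w (Finset.mem_filter.1 hw).2.1
    linarith
  · have := key w (Finset.mem_filter.1 hw).2.1
    linarith
  · have := key' w
    linarith

open Classical in
/-- One coin per node, independent over the nodes: the coin of `v` shows `true` (`v` is informed)
with probability `1 - p*(v)`, and `false` with probability `p*(v)`. -/
def coins [Fintype V] (G : SimpleGraph V) (c : Config V) : PMF (V → Bool) :=
  PMF.ofFintype
    (fun b => ∏ v, ENNReal.ofReal (if b v then 1 - stayProb G c v else stayProb G c v)) (by
      rw [← Fintype.prod_sum
        (fun v (x : Bool) => ENNReal.ofReal (if x then 1 - stayProb G c v else stayProb G c v))]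
      apply Finset.prod_eq_one
      intro v _
      have h := stayProb_mem G c v
      rw [Fintype.sum_bool, ← ENNReal.ofReal_add]
      · simp
      · simpa using h.2
      · simpa using h.1)

/-- The simultaneous color update for given coins: orange nodes stay orange, a red node that has
been red for `k` rounds becomes orange and stays red before, and an uncolored node becomes red
if its coin says so. -/
def update (k : ℕ) (c : Config V) (b : V → Bool) : Config V := fun v =>
  match c v with
  | (Color.orange, j) => (Color.orange, j)
  | (Color.red, j) => if j < k then (Color.red, j + 1) else (Color.orange, j)
  | (Color.uncolored, j) => if b v then (Color.red, j + 1) else (Color.uncolored, j)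

/-- One round of the process. -/
def step [Fintype V] (G : SimpleGraph V) (k : ℕ) (c : Config V) : PMF (Config V) :=
  (coins G c).map (update k c)

/-- The law of the configuration after `t` rounds, started with the single red node `v₀`. -/
def law [Fintype V] (G : SimpleGraph V) (k : ℕ) (v₀ : V) : ℕ → PMF (Config V)
  | 0 => PMF.pure (initial v₀)
  | t + 1 => (law G k v₀ t).bind (step G k)

/-- The probability of an event. -/
def prob {α : Type*} (p : PMF α) (E : Set α) : ℝ := (p.toOuterMeasure E).toReal

/-- The configurations in which at least a fraction `α` of all nodes is orange. -/
def orangeFractionGE [Fintype V] (α : ℝ) : Set (Config V) :=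
  {c | α * (Fintype.card V : ℝ) ≤ ({v | (c v).1 = Color.orange}.ncard : ℝ)}

/-! ### Moderate expanders -/

open Classical in
/-- The second-largest absolute value of the eigenvalues (with multiplicity) of the adjacency
matrix.  The eigenvalues are listed in decreasing order; the first one is the largest one in
absolute value, because the matrix has nonnegative entries. -/
def secondEigenvalue {W : Type*} [Fintype W] (H : SimpleGraph W) : ℝ :=
  ⨆ i : {i : Fin (Fintype.card W) // 0 < (i : ℕ)},
    |(H.isHermitian_adjMatrix ℝ).eigenvalues₀ i.1|

/-- `G` arises from `H` by replacing every node `x` with a clique of size `L` (the super node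
`π ⁻¹ {x}`) and turning every edge `{x, y}` of `H` into exactly one edge between the super nodes
of `x` and `y`, such that every node of `G` receives exactly `d` of these edges. -/
structure IsCliqueReplacement {V W : Type*} (H : SimpleGraph W) (L d : ℕ) (G : SimpleGraph V)
    (π : V → W) : Prop where
  card_superNode : ∀ x, {v | π v = x}.ncard = L
  clique : ∀ v w, π v = π w → v ≠ w → G.Adj v w
  adj_of_adj : ∀ v w, G.Adj v w → π v ≠ π w → H.Adj (π v) (π w)
  existsUnique_edge : ∀ x y, H.Adj x y → ∃! e : V × V, π e.1 = x ∧ π e.2 = y ∧ G.Adj e.1 e.2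
  evenly : ∀ v, {w | G.Adj v w ∧ π w ≠ π v}.ncard = d

open Classical in
/-- `G` is an `(n, d)`-moderate expander with spectral constant `C`.  The super nodes have size
`log² n`, rounded down or up to an integer. -/
def IsModerateExpander (C : ℝ) (n d : ℕ) (G : SimpleGraph (Fin n)) : Prop :=
  ∃ (L N : ℕ) (H : SimpleGraph (Fin N)) (π : Fin n → Fin N),
    (L = ⌊Real.log n ^ 2⌋₊ ∨ L = ⌈Real.log n ^ 2⌉₊) ∧
    n = N * L ∧
    H.IsRegularOfDegree (d * L) ∧
    secondEigenvalue H ≤ C * √((d * L : ℕ) : ℝ) ∧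
    IsCliqueReplacement H L d G π

end RumorSpreading

end

/-!
The graph consists of `N` cliques of `L ≈ log² n` nodes; the edges between the cliques form a
`D`-regular expander `H` on the cliques, `D = d * L`.

**Fast spreading.**  Inside a clique the similarity of nodes is of constant order, so that a clique
with one fresh (newly red) node has a constant fraction of fresh nodes one round later and is
completely colored after two rounds, up to a failure probability `exp (-Ω(L))` that is smaller than
every power of `n` (`coinProb_not_progress_le`).  An edge between two cliques transmits with
probability of order `1 / L`, so that a clique touches of order `d` other cliques two rounds
after it was touched itself.  Overlaps are controlled by the spectral gap, in the form of a variance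
bound for the numbers of neighbors in a set of cliques (`sum_nbrCount_sub_sq_le`):
if the cliques in `A` transmit and the set `I` of touched cliques is neither larger than a small
multiple of `N` nor than a small multiple of `D * |A|`, then the expected number of newly touched
cliques is at least proportional to `min (d * |A|) N` (`le_sum_one_sub_exp`), and a Chernoff bound
applies (`coinProb_card_blocks_le`).

The number of fresh cliques therefore grows by the factor `r = √d` within at most two rounds, until
a constant fraction of all cliques is touched in one round (`hitProb_add_two_ge_of_seeded`).  The
failure probabilities of these steps form a geometric series whose sum is of order `1 / d`
(`hitProb_ge_of_seeded`); this is where `d → ∞` is needed.  Once a constant fraction of the cliques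
is fresh, by the variance bound all but `O(N / D)` cliques receive of order `D` edges from them, and
by Markov's inequality almost all cliques are touched two rounds later (`hitProb_ge_of_fresh`).
Two more rounds fill the touched cliques and `k` more rounds make them orange.  The whole takes at
most `2 * log_r n + O(1) ≤ 5 * log_d n` rounds, because `log_d n → ∞`.

The states of the growth phase are reached at random times.  This does no harm, because all
estimates are lower bounds for the probability `hitProb T c` to see the required number of orange
nodes `T` rounds after the configuration `c`, which is nondecreasing in `T`.

**Failure for constant `d`.**  Along an edge between two cliques the similarity is at most
`(d + 1) / L`, and over all rounds a node transmits along it with total strength at most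
`∑ 2 ^ (-j) ≤ 1` times this.  The `d * L` edges that leave the first clique hence all fail to
transmit with probability at least `exp (-2 * (d + 1) * d)` (`exp_le_prob_law`), and a single clique
is too small.
-/

noncomputable section

namespace RumorSpreading

open scoped Classical

/-! ### Independent coins -/

/-- The expectation of `f b`, where the coins `b v` are independent and `b v` shows `true` with
probability `p v`. -/
def coinExp {V : Type*} [Fintype V] (p : V → ℝ) (f : (V → Bool) → ℝ) : ℝ :=
  ∑ b, (∏ v, if b v then p v else 1 - p v) * f b

/-- The probability of the event `P` under independent coins with success probabilities `p`. -/
def coinProb {V : Type*} [Fintype V] (p : V → ℝ) (P : (V → Bool) → Prop) : ℝ :=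
  coinExp p (fun b => if P b then 1 else 0)

section Coins

variable {V : Type*} [Fintype V] {p : V → ℝ}

lemma coinExp_prod (p : V → ℝ) (g : V → Bool → ℝ) :
    coinExp p (fun b => ∏ v, g v (b v)) = ∏ v, (p v * g v true + (1 - p v) * g v false) := by
  unfold coinExp
  simp_rw [← Finset.prod_mul_distrib]
  rw [← Fintype.prod_sum (fun v (x : Bool) => (if x then p v else 1 - p v) * g v x)]
  simp

lemma coinExp_const (p : V → ℝ) (a : ℝ) : coinExp p (fun _ => a) = a := by
  have h := coinExp_prod p (fun _ _ => 1)
  have h' : coinExp p (fun _ => a) = coinExp p (fun _ => ∏ _v : V, (1 : ℝ)) * a := by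
    simp [coinExp, Finset.sum_mul]
  rw [h', h]
  simp

lemma coinExp_mono (hp : ∀ v, 0 ≤ p v ∧ p v ≤ 1) {f g : (V → Bool) → ℝ} (h : ∀ b, f b ≤ g b) :
    coinExp p f ≤ coinExp p g := by
  refine Finset.sum_le_sum fun b _ => mul_le_mul_of_nonneg_left (h b) ?_
  refine Finset.prod_nonneg fun v _ => ?_
  split_ifs
  · exact (hp v).1
  · linarith [(hp v).2]

lemma coinExp_add (f g : (V → Bool) → ℝ) :
    coinExp p (fun b => f b + g b) = coinExp p f + coinExp p g := by
  simp [coinExp, mul_add, Finset.sum_add_distrib]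

lemma coinExp_sub (f g : (V → Bool) → ℝ) :
    coinExp p (fun b => f b - g b) = coinExp p f - coinExp p g := by
  simp [coinExp, mul_sub, Finset.sum_sub_distrib]

lemma coinExp_mul_left (a : ℝ) (f : (V → Bool) → ℝ) :
    coinExp p (fun b => a * f b) = a * coinExp p f := by
  simp [coinExp, Finset.mul_sum, mul_left_comm]

lemma coinExp_sum {ι : Type*} (s : Finset ι) (f : ι → (V → Bool) → ℝ) :
    coinExp p (fun b => ∑ i ∈ s, f i b) = ∑ i ∈ s, coinExp p (f i) := by
  simp only [coinExp, Finset.mul_sum]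
  rw [Finset.sum_comm]

lemma coinExp_nonneg (hp : ∀ v, 0 ≤ p v ∧ p v ≤ 1) {f : (V → Bool) → ℝ} (h : ∀ b, 0 ≤ f b) :
    0 ≤ coinExp p f := by
  simpa [coinExp_const] using coinExp_mono hp h

lemma coinProb_mono (hp : ∀ v, 0 ≤ p v ∧ p v ≤ 1) {P Q : (V → Bool) → Prop}
    (h : ∀ b, P b → Q b) : coinProb p P ≤ coinProb p Q := by
  refine coinExp_mono hp fun b => ?_
  by_cases hP : P b
  · simp [hP, h b hP]
  · simp only [hP, if_false]
    split_ifs <;> norm_num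

lemma coinProb_or_le (hp : ∀ v, 0 ≤ p v ∧ p v ≤ 1) (P Q : (V → Bool) → Prop) :
    coinProb p (fun b => P b ∨ Q b) ≤ coinProb p P + coinProb p Q := by
  unfold coinProb
  rw [← coinExp_add]
  refine coinExp_mono hp fun b => ?_
  by_cases hP : P b <;> by_cases hQ : Q b <;> simp [hP, hQ]

lemma coinProb_exists_le {ι : Type*} (hp : ∀ v, 0 ≤ p v ∧ p v ≤ 1) (s : Finset ι)
    (P : ι → (V → Bool) → Prop) :
    coinProb p (fun b => ∃ i ∈ s, P i b) ≤ ∑ i ∈ s, coinProb p (P i) := by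
  unfold coinProb
  rw [← coinExp_sum]
  refine coinExp_mono hp fun b => ?_
  have hnn : ∀ i ∈ s, (0 : ℝ) ≤ if P i b then 1 else 0 := fun i _ => by split_ifs <;> norm_num
  split_ifs with h
  · obtain ⟨i, hi, hP⟩ := h
    simpa [hP] using Finset.single_le_sum hnn hi
  · exact Finset.sum_nonneg hnn

/-- A lower bound that holds off an exceptional event costs only the probability of that event. -/
lemma coinExp_ge_of_off (hp : ∀ v, 0 ≤ p v ∧ p v ≤ 1) {f g : (V → Bool) → ℝ}
    {B : (V → Bool) → Prop} (hf : ∀ b, 0 ≤ f b) (hg : ∀ b, g b ≤ 1)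
    (h : ∀ b, ¬ B b → g b ≤ f b) : coinExp p g - coinProb p B ≤ coinExp p f := by
  unfold coinProb
  rw [← coinExp_sub]
  refine coinExp_mono hp fun b => ?_
  by_cases hB : B b
  · simpa [hB] using (hg b).trans (by linarith [hf b])
  · simpa [hB] using h b hB

/-- The product over a set of nodes of the indicators of `b v = false`. -/
lemma coinExp_prod_false (p : V → ℝ) (U : Finset V) :
    coinExp p (fun b => ∏ v ∈ U, if b v then 0 else 1) = ∏ v ∈ U, (1 - p v) := by
  have h := coinExp_prod p (fun v x => if v ∈ U then (if x then 0 else 1) else 1)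
  simp only [Finset.prod_ite_mem, Finset.univ_inter] at h
  rw [h, ← Finset.prod_subset (Finset.subset_univ U)]
  · refine Finset.prod_congr rfl fun v hv => ?_
    simp [hv]
  · intro v _ hv
    simp [hv]

lemma prod_ite_false (U : Finset V) (b : V → Bool) :
    (∏ v ∈ U, if b v then (0 : ℝ) else 1) = if ∀ v ∈ U, b v = false then 1 else 0 := by
  split_ifs with h
  · exact Finset.prod_eq_one fun v hv => by simp [h v hv]
  · push Not at h
    obtain ⟨v, hv, hb⟩ := h
    exact Finset.prod_eq_zero hv (by simpa using hb)

lemma coinProb_forall_false (p : V → ℝ) (U : Finset V) :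
    coinProb p (fun b => ∀ v ∈ U, b v = false) = ∏ v ∈ U, (1 - p v) := by
  rw [← coinExp_prod_false]
  unfold coinProb
  congr 1
  funext b
  rw [prod_ite_false]
  congr

/-- Functions of disjoint blocks of coins are independent; here for the functions that decide
whether a block is `false` throughout. -/
lemma coinExp_prod_blocks {ι : Type*} (p : V → ℝ) (Y : Finset ι) (U : ι → Finset V)
    (hU : (Y : Set ι).PairwiseDisjoint U) (a a' : ℝ) :
    coinExp p (fun b => ∏ y ∈ Y, (a + a' * ∏ v ∈ U y, if b v then 0 else 1)) =
      ∏ y ∈ Y, (a + a' * ∏ v ∈ U y, (1 - p v)) := by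
  simp_rw [Finset.prod_add]
  rw [coinExp_sum]
  refine Finset.sum_congr rfl fun t ht => ?_
  rw [coinExp_mul_left]
  congr 1
  simp_rw [Finset.prod_mul_distrib]
  rw [coinExp_mul_left]
  congr 1
  have hd : ((Y \ t : Finset ι) : Set ι).PairwiseDisjoint U :=
    hU.subset (by simp)
  simp_rw [← Finset.prod_biUnion hd]
  exact coinExp_prod_false p _

/-- A Chernoff bound for the number of blocks, out of a family of disjoint blocks of coins, that
contain a `true` coin. -/
lemma coinProb_card_blocks_le {ι : Type*} (hp : ∀ v, 0 ≤ p v ∧ p v ≤ 1) (Y : Finset ι)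
    (U : ι → Finset V) (hU : (Y : Set ι).PairwiseDisjoint U) {m : ℝ}
    (hm : m ≤ ∑ y ∈ Y, (1 - ∏ v ∈ U y, (1 - p v))) :
    coinProb p (fun b => (((Y.filter fun y => ∃ v ∈ U y, b v = true).card : ℕ) : ℝ) ≤ m / 4) ≤
      Real.exp (-(m / 4)) := by
  have hpt : ∀ b : V → Bool,
      (if (((Y.filter fun y => ∃ v ∈ U y, b v = true).card : ℕ) : ℝ) ≤ m / 4 then (1 : ℝ) else 0) ≤
      Real.exp (m / 4) * ∏ y ∈ Y, (1 / 2 + 1 / 2 * ∏ v ∈ U y, if b v then (0 : ℝ) else 1) := by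
    intro b
    have hprod : ∏ y ∈ Y, (1 / 2 + 1 / 2 * ∏ v ∈ U y, if b v then (0 : ℝ) else 1) =
        (1 / 2 : ℝ) ^ (Y.filter fun y => ∃ v ∈ U y, b v = true).card := by
      rw [← Finset.prod_const, Finset.prod_filter]
      refine Finset.prod_congr rfl fun y _ => ?_
      rw [prod_ite_false]
      by_cases h : ∃ v ∈ U y, b v = true
      · rw [if_pos h, if_neg]
        · norm_num
        · obtain ⟨v, hv, hb⟩ := h
          intro hc
          simp [hc v hv] at hb
      · rw [if_neg h, if_pos]
        · norm_num
        · intro v hv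
          by_contra hc
          exact h ⟨v, hv, by simpa using hc⟩
    rw [hprod]
    split_ifs with h
    · have h2 : Real.exp (-1) ≤ 1 / 2 := by
        have := Real.exp_one_gt_d9
        rw [Real.exp_neg, inv_le_comm₀ (Real.exp_pos _) (by norm_num)]
        norm_num
        linarith
      calc (1 : ℝ) ≤ Real.exp (m / 4) *
            Real.exp (-1) ^ (Y.filter fun y => ∃ v ∈ U y, b v = true).card := by
            rw [← Real.exp_nat_mul, ← Real.exp_add]
            exact Real.one_le_exp (by linarith)
        _ ≤ _ := by gcongr
    · positivity
  have hq : ∀ y ∈ Y, 0 ≤ ∏ v ∈ U y, (1 - p v) := fun y _ =>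
    Finset.prod_nonneg fun v _ => by linarith [(hp v).2]
  calc _ ≤ _ := coinExp_mono hp hpt
    _ = Real.exp (m / 4) * ∏ y ∈ Y, (1 / 2 + 1 / 2 * ∏ v ∈ U y, (1 - p v)) := by
      rw [coinExp_mul_left, coinExp_prod_blocks p Y U hU]
    _ ≤ Real.exp (m / 4) * Real.exp (-(m / 2)) := by
      gcongr
      calc _ ≤ ∏ y ∈ Y, Real.exp (-((1 - ∏ v ∈ U y, (1 - p v)) / 2)) := by
            refine Finset.prod_le_prod (fun y hy => by linarith [hq y hy]) fun y hy => ?_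
            have := Real.add_one_le_exp (-((1 - ∏ v ∈ U y, (1 - p v)) / 2))
            linarith
        _ = Real.exp (-((∑ y ∈ Y, (1 - ∏ v ∈ U y, (1 - p v))) / 2)) := by
            rw [← Real.exp_sum, Finset.sum_neg_distrib, Finset.sum_div]
        _ ≤ _ := by
            gcongr
    _ = Real.exp (-(m / 4)) := by
      rw [← Real.exp_add]
      ring_nf

/-- The Chernoff bound for the number of `true` coins in a set of nodes. -/
lemma coinProb_card_le (hp : ∀ v, 0 ≤ p v ∧ p v ≤ 1) (U : Finset V) {q : ℝ}
    (h : ∀ v ∈ U, q ≤ p v) :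
    coinProb p (fun b => (((U.filter fun v => b v = true).card : ℕ) : ℝ) ≤ q * U.card / 4) ≤
      Real.exp (-(q * U.card / 4)) := by
  have key := coinProb_card_blocks_le hp U (fun v => {v}) (m := q * U.card)
    (fun x _ y _ hxy => by simpa using hxy) (by
      rw [mul_comm, ← nsmul_eq_mul]
      refine Finset.card_nsmul_le_sum _ _ _ fun v hv => ?_
      simpa using h v hv)
  simpa using key

end Coins

/-! ### The probability of an event after a number of rounds -/

section HitProb

variable {V : Type*} [Fintype V]

/-- The probability that a node is informed in the next round if it is uncolored. -/
def informProb (G : SimpleGraph V) (c : Config V) (v : V) : ℝ := 1 - stayProb G c v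

lemma informProb_mem (G : SimpleGraph V) (c : Config V) (v : V) :
    0 ≤ informProb G c v ∧ informProb G c v ≤ 1 := by
  have := stayProb_mem G c v
  unfold informProb
  constructor <;> linarith

/-- The probability that the configuration lies in `E` after `T` rounds started from `c`, given
by conditioning on the first round. -/
def hitProb (G : SimpleGraph V) (k : ℕ) (E : Set (Config V)) : ℕ → Config V → ℝ
  | 0, c => if c ∈ E then 1 else 0
  | T + 1, c => coinExp (informProb G c) (fun b => hitProb G k E T (update k c b))

variable (G : SimpleGraph V) (k : ℕ) (E : Set (Config V))

lemma hitProb_nonneg (T : ℕ) (c : Config V) : 0 ≤ hitProb G k E T c := by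
  induction T generalizing c with
  | zero => unfold hitProb; split_ifs <;> norm_num
  | succ T ih => exact coinExp_nonneg (informProb_mem G c) fun b => ih _

lemma coins_apply (c : Config V) (b : V → Bool) :
    coins G c b = ENNReal.ofReal (∏ v, if b v then informProb G c v else 1 - informProb G c v) := by
  have h : coins G c b =
      ∏ v, ENNReal.ofReal (if b v then 1 - stayProb G c v else stayProb G c v) := rfl
  rw [h, ENNReal.ofReal_prod_of_nonneg]
  · simp [informProb]
  · intro v _
    have := informProb_mem G c v
    split_ifs <;> linarith

lemma tsum_step_mul (c : Config V) (g : Config V → ℝ) (hg : ∀ c, 0 ≤ g c) :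
    ∑' c', step G k c c' * ENNReal.ofReal (g c') =
      ENNReal.ofReal (coinExp (informProb G c) (fun b => g (update k c b))) := by
  have hw : ∀ b : V → Bool,
      0 ≤ ∏ v, if b v then informProb G c v else 1 - informProb G c v := fun b => by
    refine Finset.prod_nonneg fun v _ => ?_
    have := informProb_mem G c v
    split_ifs <;> linarith
  unfold step
  simp_rw [PMF.map_apply, ← ENNReal.tsum_mul_right]
  rw [ENNReal.tsum_comm]
  refine (tsum_congr fun b => tsum_eq_single (update k c b) fun c' hc' => by simp [hc']).trans ?_
  simp only [if_true]
  rw [tsum_fintype, coinExp, ENNReal.ofReal_sum_of_nonneg fun b _ => mul_nonneg (hw b) (hg _)]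
  refine Finset.sum_congr rfl fun b _ => ?_
  rw [coins_apply, ENNReal.ofReal_mul (hw b)]

lemma law_toOuterMeasure (v₀ : V) (T t : ℕ) :
    (law G k v₀ (t + T)).toOuterMeasure E =
      ∑' c, law G k v₀ t c * ENNReal.ofReal (hitProb G k E T c) := by
  induction T generalizing t with
  | zero =>
    rw [PMF.toOuterMeasure_apply]
    refine tsum_congr fun c => ?_
    by_cases h : c ∈ E <;> simp [hitProb, h]
  | succ T ih =>
    rw [← Nat.add_assoc, Nat.add_right_comm, ih (t + 1)]
    have hlaw : ∀ c, law G k v₀ (t + 1) c = ∑' a, law G k v₀ t a * step G k a c := fun c =>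
      PMF.bind_apply _ _ _
    simp_rw [hlaw, ← ENNReal.tsum_mul_right]
    rw [ENNReal.tsum_comm]
    refine tsum_congr fun c => ?_
    simp_rw [mul_assoc, ENNReal.tsum_mul_left]
    rw [tsum_step_mul G k c _ (hitProb_nonneg G k E T)]
    rfl

lemma prob_law_eq (v₀ : V) (T : ℕ) :
    prob (law G k v₀ T) E = hitProb G k E T (initial v₀) := by
  have h := law_toOuterMeasure G k E v₀ T 0
  rw [zero_add] at h
  rw [prob, h, tsum_eq_single (initial v₀)]
  · simp [law, ENNReal.toReal_ofReal (hitProb_nonneg G k E T _)]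
  · intro c hc
    simp [law, hc]

variable {G k E}

/-- A lower bound for the next value of `hitProb` off an exceptional event of the coins. -/
lemma hitProb_succ_ge {T : ℕ} {c : Config V} {ε : ℝ} (hε : 0 ≤ ε) (B : (V → Bool) → Prop)
    (h : ∀ b, ¬ B b → 1 - ε ≤ hitProb G k E T (update k c b)) :
    1 - ε - coinProb (informProb G c) B ≤ hitProb G k E (T + 1) c := by
  have := coinExp_ge_of_off (informProb_mem G c) (f := fun b => hitProb G k E T (update k c b))
    (g := fun _ => 1 - ε) (B := B) (fun b => hitProb_nonneg G k E T _) (fun _ => by linarith) h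
  rwa [coinExp_const] at this

lemma hitProb_mono (hE : ∀ c ∈ E, ∀ b, update k c b ∈ E) {T T' : ℕ} (h : T ≤ T') (c : Config V) :
    hitProb G k E T c ≤ hitProb G k E T' c := by
  have hstep : ∀ T c, hitProb G k E T c ≤ hitProb G k E (T + 1) c := by
    intro T
    induction T with
    | zero =>
      intro c
      by_cases hc : c ∈ E
      · simp [hitProb, hc, hE c hc, coinExp_const]
      · simpa [hitProb, hc] using hitProb_nonneg G k E 1 c
    | succ T ih => exact fun c => coinExp_mono (informProb_mem G c) fun b => ih _
  induction h with
  | refl => exact le_rfl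
  | step _ ih => exact ih.trans (hstep _ c)

end HitProb

/-! ### Clique replacements -/

section CliqueReplacement

variable {V W : Type*} {H : SimpleGraph W} {L d : ℕ} {G : SimpleGraph V}
  {π : V → W}

/-- The nodes of the clique that replaces `x`. -/
def superNode [Fintype V] (π : V → W) (x : W) : Finset V := Finset.univ.filter fun v => π v = x

@[simp] lemma mem_superNode [Fintype V] {x : W} {v : V} : v ∈ superNode π x ↔ π v = x := by
  simp [superNode]

/-- The node `w` lies outside of the clique of `y` and has a neighbor in it. -/
def Reaches (G : SimpleGraph V) (π : V → W) (w : V) (y : W) : Prop :=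
  π w ≠ y ∧ ∃ v, π v = y ∧ G.Adj w v

/-- The number of nodes of `R` that reach the clique of `y`.  In a clique replacement this is the
number of edges that join `R` to this clique from outside. -/
def reachCount (G : SimpleGraph V) (π : V → W) (R : Finset V) (y : W) : ℕ :=
  (R.filter fun w => Reaches G π w y).card

/-- The number of neighbors of `y` in `A`. -/
def nbrCount (H : SimpleGraph W) (A : Finset W) (y : W) : ℕ := (A.filter fun x => H.Adj x y).card

namespace IsCliqueReplacement

lemma card_superNode' [Fintype V] (hG : IsCliqueReplacement H L d G π) (x : W) :
    (superNode π x).card = L := by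
  rw [← hG.card_superNode x, ← Set.ncard_coe_finset]
  congr 1
  ext v
  simp

/-- Two nodes of a clique do not have neighbors in the same other clique, and one node does not
have two of them. -/
lemma edge_unique (hG : IsCliqueReplacement H L d G π) {v w v' w' : V} (h : G.Adj v w)
    (h' : G.Adj v' w') (hv : π v = π v') (hw : π w = π w') (hne : π v ≠ π w) :
    v = v' ∧ w = w' := by
  have := (hG.existsUnique_edge _ _ (hG.adj_of_adj v w h hne)).unique
    (y₁ := (v, w)) (y₂ := (v', w')) ⟨rfl, rfl, h⟩ ⟨hv.symm, hw.symm, h'⟩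
  simpa using this

lemma card_reached [Fintype V] [Fintype W] (hG : IsCliqueReplacement H L d G π) (w : V) :
    (Finset.univ.filter fun y => Reaches G π w y).card = d := by
  have h1 : (Finset.univ.filter fun v => G.Adj w v ∧ π v ≠ π w).card = d := by
    rw [← hG.evenly w, ← Set.ncard_coe_finset]
    congr 1
    ext v
    simp
  rw [← h1]
  symm
  refine Finset.card_bij (fun v _ => π v) ?_ ?_ ?_
  · intro v hv
    simp only [Finset.mem_filter, Finset.mem_univ, true_and] at hv ⊢
    exact ⟨hv.2.symm, v, rfl, hv.1⟩
  · intro v hv v' hv' h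
    simp only [Finset.mem_filter, Finset.mem_univ, true_and] at hv hv'
    exact (hG.edge_unique hv.1 hv'.1 rfl h hv.2.symm).2
  · intro y hy
    simp only [Finset.mem_filter, Finset.mem_univ, true_and] at hy
    obtain ⟨hne, v, rfl, hv⟩ := hy
    exact ⟨v, by simp [hv, hne.symm], rfl⟩

lemma sum_reachCount [Fintype V] [Fintype W] (hG : IsCliqueReplacement H L d G π) (R : Finset V) :
    ∑ y, reachCount G π R y = d * R.card := by
  have h := Finset.sum_card_bipartiteAbove_eq_sum_card_bipartiteBelow (s := R)
    (t := (Finset.univ : Finset W)) (Reaches G π)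
  simp only [Finset.bipartiteAbove, Finset.bipartiteBelow] at h
  unfold reachCount
  rw [← h, Finset.sum_congr rfl fun w _ => hG.card_reached w]
  simp [mul_comm]

lemma reachCount_le_nbrCount (hG : IsCliqueReplacement H L d G π) {R : Finset V} {A : Finset W}
    (hR : ∀ w ∈ R, π w ∈ A) (y : W) : reachCount G π R y ≤ nbrCount H A y := by
  refine Finset.card_le_card_of_injOn π ?_ ?_
  · intro w hw
    simp only [Finset.coe_filter, Set.mem_ofPred_eq] at hw ⊢
    obtain ⟨hw, hne, v, rfl, hv⟩ := hw
    exact ⟨hR w hw, hG.adj_of_adj _ _ hv hne⟩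
  · intro w hw w' hw' h
    simp only [Finset.coe_filter, Set.mem_ofPred_eq] at hw hw'
    obtain ⟨-, hne, v, rfl, hv⟩ := hw
    obtain ⟨-, -, v', hv', hvv'⟩ := hw'
    exact (hG.edge_unique hv hvv' h hv'.symm hne).1

lemma nbrCount_le_reachCount [Fintype V] (hG : IsCliqueReplacement H L d G π)
    (A : Finset W) (y : W) :
    nbrCount H A y ≤ reachCount G π (Finset.univ.filter fun w => π w ∈ A) y := by
  refine Finset.card_le_card_of_surjOn π ?_
  intro x hx
  simp only [Finset.coe_filter, Set.mem_ofPred_eq] at hx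
  obtain ⟨e, ⟨h1, h2, h3⟩, -⟩ := hG.existsUnique_edge x y hx.2
  refine ⟨e.1, ?_, h1⟩
  simp only [Finset.coe_filter, Set.mem_ofPred_eq, Finset.mem_filter, Finset.mem_univ, true_and]
  exact ⟨h1 ▸ hx.1, by rw [h1]; exact hx.2.ne, e.2, h2, h3⟩

lemma neighborSet_subset (v : V) :
    G.neighborSet v ⊆ {w | π w = π v} ∪ {w | G.Adj v w ∧ π w ≠ π v} := by
  intro w hw
  by_cases h : π w = π v
  · exact Or.inl h
  · exact Or.inr ⟨hw, h⟩

lemma superNode_subset_closedNbhd (hG : IsCliqueReplacement H L d G π) (v : V) :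
    {w | π w = π v} ⊆ closedNbhd G v := by
  intro w hw
  by_cases h : w = v
  · exact Or.inl h
  · exact Or.inr (hG.clique v w (Eq.symm hw) (Ne.symm h))

lemma L_pos [Finite V] (hG : IsCliqueReplacement H L d G π) (v : V) : 0 < L := by
  rw [← hG.card_superNode (π v)]
  exact (Set.ncard_pos (Set.toFinite _)).2 ⟨v, rfl⟩

lemma ncard_neighborSet_le [Finite V] (hG : IsCliqueReplacement H L d G π) (v : V) :
    (G.neighborSet v).ncard ≤ L + d := by
  rw [← hG.card_superNode (π v), ← hG.evenly v]
  exact (Set.ncard_le_ncard (neighborSet_subset v) (Set.toFinite _)).trans (Set.ncard_union_le _ _)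

lemma similarity_ge_of_same [Finite V] (hG : IsCliqueReplacement H L d G π) {v w : V}
    (h : π v = π w) (hvw : G.Adj v w) : (L : ℝ) / (L + 2 * d) ≤ similarity G v w := by
  have h1 : L ≤ (closedNbhd G v ∩ closedNbhd G w).ncard := by
    rw [← hG.card_superNode (π v)]
    refine Set.ncard_le_ncard (Set.subset_inter (hG.superNode_subset_closedNbhd v) ?_)
      (Set.toFinite _)
    rw [h]
    exact hG.superNode_subset_closedNbhd w
  have h2 : (G.neighborSet v ∪ G.neighborSet w).ncard ≤ L + 2 * d := by
    have hsub : G.neighborSet v ∪ G.neighborSet w ⊆ {x | π x = π v} ∪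
        ({x | G.Adj v x ∧ π x ≠ π v} ∪ {x | G.Adj w x ∧ π x ≠ π w}) := by
      have hv := neighborSet_subset (G := G) (π := π) v
      have hw := neighborSet_subset (G := G) (π := π) w
      rw [← h] at hw
      rintro x (hx | hx)
      · rcases hv hx with hx | hx
        · exact Or.inl hx
        · exact Or.inr (Or.inl hx)
      · rcases hw hx with hx | hx
        · exact Or.inl hx
        · exact Or.inr (Or.inr (h ▸ hx))
    have := Set.ncard_le_ncard hsub (Set.toFinite _)
    have h3 := Set.ncard_union_le {x | π x = π v}
      ({x | G.Adj v x ∧ π x ≠ π v} ∪ {x | G.Adj w x ∧ π x ≠ π w})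
    have h4 := Set.ncard_union_le {x | G.Adj v x ∧ π x ≠ π v} {x | G.Adj w x ∧ π x ≠ π w}
    rw [hG.card_superNode] at h3
    rw [hG.evenly, hG.evenly] at h4
    omega
  have h0 : 0 < (G.neighborSet v ∪ G.neighborSet w).ncard :=
    (Set.ncard_pos (Set.toFinite _)).2 ⟨w, Or.inl hvw⟩
  unfold similarity
  refine div_le_div₀ (by positivity) (by exact_mod_cast h1) (by exact_mod_cast h0) ?_
  exact_mod_cast h2

lemma similarity_ge_of_ne [Finite V] (hG : IsCliqueReplacement H L d G π) {v w : V}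
    (hvw : G.Adj v w) : (1 : ℝ) / (L + d) ≤ similarity G v w := by
  have h1 : 2 ≤ (closedNbhd G v ∩ closedNbhd G w).ncard := by
    rw [← Set.ncard_pair hvw.ne]
    refine Set.ncard_le_ncard ?_ (Set.toFinite _)
    rintro x (rfl | rfl)
    · exact ⟨Or.inl rfl, Or.inr hvw.symm⟩
    · exact ⟨Or.inr hvw, Or.inl rfl⟩
  have h2 : (G.neighborSet v ∪ G.neighborSet w).ncard ≤ 2 * (L + d) := by
    have := Set.ncard_union_le (G.neighborSet v) (G.neighborSet w)
    have := hG.ncard_neighborSet_le v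
    have := hG.ncard_neighborSet_le w
    omega
  have h0 : 0 < (G.neighborSet v ∪ G.neighborSet w).ncard :=
    (Set.ncard_pos (Set.toFinite _)).2 ⟨w, Or.inl hvw⟩
  have hL : (0 : ℝ) < L := by exact_mod_cast hG.L_pos v
  have h3 : (1 : ℝ) / (L + d) = 2 / (2 * (L + d)) := by
    field_simp
  rw [h3]
  unfold similarity
  refine div_le_div₀ (by positivity) (by exact_mod_cast h1) (by exact_mod_cast h0) ?_
  exact_mod_cast h2

/-- Common neighbors of the end nodes of an edge between two cliques lie in a third clique, because
there is only one edge between two cliques. -/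
lemma similarity_le_of_ne [Finite V] (hG : IsCliqueReplacement H L d G π) {v w : V}
    (hvw : G.Adj v w) (h : π v ≠ π w) : similarity G v w ≤ (d + 1) / L := by
  have h1 : (closedNbhd G v ∩ closedNbhd G w).ncard ≤ d + 1 := by
    have hsub : closedNbhd G v ∩ closedNbhd G w ⊆ insert v {x | G.Adj v x ∧ π x ≠ π v} := by
      rintro x ⟨rfl | hx, hx'⟩
      · exact Or.inl rfl
      · refine Or.inr ⟨hx, fun hπ => ?_⟩
        rcases hx' with rfl | hx'
        · exact h hπ.symm
        · exact G.ne_of_adj hx (hG.edge_unique hvw (G.adj_symm hx') hπ.symm rfl h).1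
    refine (Set.ncard_le_ncard hsub (Set.toFinite _)).trans ((Set.ncard_insert_le _ _).trans ?_)
    rw [hG.evenly]
  have h2 : L ≤ (G.neighborSet v ∪ G.neighborSet w).ncard := by
    rw [← hG.card_superNode (π v)]
    refine Set.ncard_le_ncard (fun x hx => ?_) (Set.toFinite _)
    rcases hG.superNode_subset_closedNbhd v hx with rfl | hx
    · exact Or.inr hvw.symm
    · exact Or.inl hx
  have hL : (0 : ℝ) < L := by exact_mod_cast hG.L_pos v
  unfold similarity
  refine div_le_div₀ (by positivity) (by exact_mod_cast h1) hL ?_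
  exact_mod_cast h2

end IsCliqueReplacement

lemma sum_nbrCount [Fintype W] {D : ℕ} (hH : H.IsRegularOfDegree D) (A : Finset W) :
    ∑ y, nbrCount H A y = D * A.card := by
  have h := Finset.sum_card_bipartiteAbove_eq_sum_card_bipartiteBelow (s := A)
    (t := (Finset.univ : Finset W)) H.Adj
  simp only [Finset.bipartiteAbove, Finset.bipartiteBelow] at h
  unfold nbrCount
  rw [← h, Finset.sum_congr rfl fun x _ => (?_ : _ = D)]
  · simp [mul_comm]
  · rw [← hH x, ← SimpleGraph.card_neighborFinset_eq_degree]
    congr 1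
    ext y
    simp

end CliqueReplacement

/-! ### The spectral gap -/

section Spectral

variable {W : Type*} [Fintype W] {H : SimpleGraph W} {D : ℕ}

/-- The coefficient of `f` with respect to an eigenvector of the adjacency matrix. -/
def eigenCoeff (H : SimpleGraph W) (f : W → ℝ) (i : W) : ℝ :=
  ∑ y, (H.isHermitian_adjMatrix ℝ).eigenvectorBasis i y * f y

lemma eigenCoeff_eq_inner (f : W → ℝ) (i : W) :
    eigenCoeff H f i =
      inner ℝ ((H.isHermitian_adjMatrix ℝ).eigenvectorBasis i) (WithLp.toLp 2 f) := by
  simp [eigenCoeff, PiLp.inner_apply, mul_comm]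

lemma sum_eigenCoeff_mul (f g : W → ℝ) :
    ∑ i, eigenCoeff H f i * eigenCoeff H g i = ∑ y, f y * g y := by
  have h := (H.isHermitian_adjMatrix ℝ).eigenvectorBasis.sum_inner_mul_inner
    (WithLp.toLp 2 f) (WithLp.toLp 2 g)
  simp only [eigenCoeff_eq_inner]
  rw [Finset.sum_congr rfl fun i _ => by rw [real_inner_comm], h]
  simp [PiLp.inner_apply, mul_comm]

lemma eigenCoeff_mulVec (f : W → ℝ) (i : W) :
    eigenCoeff H ((H.adjMatrix ℝ).mulVec f) i =
      (H.isHermitian_adjMatrix ℝ).eigenvalues i * eigenCoeff H f i := by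
  have h := (H.isHermitian_adjMatrix ℝ).mulVec_eigenvectorBasis i
  change dotProduct _ _ = _ * dotProduct _ _
  rw [Matrix.dotProduct_mulVec, ← Matrix.mulVec_transpose, SimpleGraph.transpose_adjMatrix, h,
    smul_dotProduct, smul_eq_mul]

lemma abs_eigenvalues_le {i₀ : Fin (Fintype.card W)} (h₀ : (i₀ : ℕ) = 0) {i : W}
    (hi : i ≠ Fintype.equivOfCardEq (Fintype.card_fin _) i₀) :
    |(H.isHermitian_adjMatrix ℝ).eigenvalues i| ≤ secondEigenvalue H := by
  set e : Fin (Fintype.card W) ≃ W := Fintype.equivOfCardEq (Fintype.card_fin _)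
  have hpos : 0 < ((e.symm i : Fin _) : ℕ) := by
    rcases Nat.eq_zero_or_pos ((e.symm i : Fin _) : ℕ) with h | h
    · refine absurd ?_ hi
      rw [← e.symm_apply_eq]
      exact Fin.ext (h.trans h₀.symm)
    · exact h
  exact le_ciSup (f := fun i : {i : Fin (Fintype.card W) // 0 < (i : ℕ)} =>
    |(H.isHermitian_adjMatrix ℝ).eigenvalues₀ i.1|) (Set.finite_range _).bddAbove ⟨e.symm i, hpos⟩

/-- On functions of mean zero, the adjacency matrix of a regular graph contracts by the second
eigenvalue.  As the degree exceeds this value, the first eigenvector is constant. -/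
lemma sum_sq_mulVec_le (hH : H.IsRegularOfDegree D) {l : ℝ} (hl : secondEigenvalue H ≤ l)
    (hlD : l < D) {f : W → ℝ} (hf : ∑ y, f y = 0) :
    ∑ y, (H.adjMatrix ℝ).mulVec f y ^ 2 ≤ l ^ 2 * ∑ y, f y ^ 2 := by
  rcases isEmpty_or_nonempty W with hW | hW
  · simp
  let i₀ : Fin (Fintype.card W) := ⟨0, Fintype.card_pos⟩
  set j : W := Fintype.equivOfCardEq (Fintype.card_fin _) i₀
  have hev : ∀ i, i ≠ j → |(H.isHermitian_adjMatrix ℝ).eigenvalues i| ≤ l := fun i hi =>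
    (abs_eigenvalues_le (i₀ := i₀) rfl hi).trans hl
  have hone : (H.adjMatrix ℝ).mulVec (fun _ => 1) = fun _ => (D : ℝ) := by
    funext y
    simpa using SimpleGraph.adjMatrix_mulVec_const_apply_of_regular (G := H) (α := ℝ) (a := 1) hH
      (v := y)
  have hc1 : ∀ i, i ≠ j → eigenCoeff H (fun _ => 1) i = 0 := by
    intro i hi
    have h1 := eigenCoeff_mulVec (H := H) (fun _ => 1) i
    rw [hone] at h1
    have h2 : eigenCoeff H (fun _ => (D : ℝ)) i = D * eigenCoeff H (fun _ => 1) i := by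
      simp [eigenCoeff, Finset.mul_sum, mul_comm]
    rw [h2] at h1
    by_contra hne
    have h3 := mul_right_cancel₀ hne h1
    have h4 := (le_abs_self _).trans (hev i hi)
    linarith
  have hj : eigenCoeff H f j = 0 := by
    have h1 := sum_eigenCoeff_mul (H := H) (fun _ => 1) f
    have h2 := sum_eigenCoeff_mul (H := H) (fun _ => 1) (fun _ => 1)
    rw [Finset.sum_eq_single j (fun i _ hi => by simp [hc1 i hi]) (by simp)] at h1 h2
    simp only [one_mul, hf, mul_eq_zero, Finset.sum_const, Finset.card_univ, nsmul_eq_mul,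
      mul_one] at h1 h2
    refine h1.resolve_left fun h => ?_
    rw [h, zero_mul] at h2
    exact Fintype.card_ne_zero (α := W) (by exact_mod_cast h2.symm)
  have hM := sum_eigenCoeff_mul (H := H) ((H.adjMatrix ℝ).mulVec f) ((H.adjMatrix ℝ).mulVec f)
  have hF := sum_eigenCoeff_mul (H := H) f f
  simp only [← sq] at hM hF
  rw [← hM, ← hF, Finset.mul_sum]
  refine Finset.sum_le_sum fun i _ => ?_
  rw [eigenCoeff_mulVec, mul_pow]
  by_cases hi : i = j
  · simp [hi, hj]
  · have h := abs_le.1 (hev i hi)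
    exact mul_le_mul_of_nonneg_right (sq_le_sq' h.1 h.2) (sq_nonneg _)

/-- The numbers of neighbors in a set `A` have small variance.  This is the form of expansion
that the analysis of the process uses. -/
lemma sum_nbrCount_sub_sq_le (hH : H.IsRegularOfDegree D) {l : ℝ} (hl : secondEigenvalue H ≤ l)
    (hlD : l < D) (A : Finset W) :
    ∑ y, ((nbrCount H A y : ℝ) - D * A.card / Fintype.card W) ^ 2 ≤ l ^ 2 * A.card := by
  rcases isEmpty_or_nonempty W with hW | hW
  · simp only [Finset.univ_eq_empty, Finset.sum_empty]
    positivity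
  have hN : (0 : ℝ) < Fintype.card W := by exact_mod_cast Fintype.card_pos
  let a : ℝ := A.card / Fintype.card W
  have hind : ∑ y, (if y ∈ A then (1 : ℝ) else 0) = A.card := by simp
  have hf : ∑ y, ((if y ∈ A then (1 : ℝ) else 0) - a) = 0 := by
    rw [Finset.sum_sub_distrib, hind]
    simp only [a, Finset.sum_const, Finset.card_univ, nsmul_eq_mul]
    field_simp
    simp
  have hf2 : ∑ y, ((if y ∈ A then (1 : ℝ) else 0) - a) ^ 2 ≤ A.card := by
    have h1 : ∀ y, ((if y ∈ A then (1 : ℝ) else 0) - a) ^ 2 =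
        (1 - a) * (if y ∈ A then (1 : ℝ) else 0) -
          a * ((if y ∈ A then (1 : ℝ) else 0) - a) := fun y => by
      split_ifs <;> ring
    rw [Finset.sum_congr rfl fun y _ => h1 y, Finset.sum_sub_distrib, ← Finset.mul_sum,
      ← Finset.mul_sum, hf, hind]
    have : 0 ≤ a * A.card := by positivity
    linarith
  have hM : ∀ y, (H.adjMatrix ℝ).mulVec (fun y => (if y ∈ A then (1 : ℝ) else 0) - a) y =
      (nbrCount H A y : ℝ) - D * A.card / Fintype.card W := by
    intro y
    rw [SimpleGraph.adjMatrix_mulVec_apply, Finset.sum_sub_distrib]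
    congr 1
    · rw [nbrCount, Finset.sum_boole]
      congr 2
      ext x
      simp [H.adj_comm x y, and_comm]
    · rw [Finset.sum_const, SimpleGraph.card_neighborFinset_eq_degree, hH y, nsmul_eq_mul]
      ring
  have := sum_sq_mulVec_le hH hl hlD hf
  rw [Finset.sum_congr rfl fun y _ => by rw [← hM y]]
  exact this.trans (by gcongr)

end Spectral

/-! ### Configurations and their updates -/

section Configurations

variable {V W : Type*} {π : V → W} {k : ℕ} {c : Config V} {b : V → Bool}

/-- The node `v` is uncolored. -/
def Unc (c : Config V) (v : V) : Prop := (c v).1 = Color.uncolored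

/-- The node `v` became red in the last round. -/
def Fresh (c : Config V) (v : V) : Prop := c v = (Color.red, 1)

/-- The counters fit the colors: they are zero at uncolored nodes and positive at red ones. -/
def WellFormed (c : Config V) : Prop :=
  ∀ v, ((c v).1 = Color.uncolored → (c v).2 = 0) ∧ ((c v).1 = Color.red → 1 ≤ (c v).2)

lemma Fresh.not_unc {v : V} (h : Fresh c v) : ¬ Unc c v := by
  unfold Fresh at h
  simp [Unc, h]

lemma unc_update_iff {v : V} : Unc (update k c b) v ↔ Unc c v ∧ b v = false := by
  unfold Unc update
  rcases h : c v with ⟨_ | _ | _, j⟩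
  · by_cases hb : b v <;> simp [hb]
  · by_cases hj : j < k <;> simp [hj]
  · simp

lemma WellFormed.fresh_update (hc : WellFormed c) {v : V} (h : Unc c v) (hb : b v = true) :
    Fresh (update k c b) v := by
  have h0 := (hc v).1 h
  unfold Unc at h
  unfold Fresh update
  rcases hv : c v with ⟨_ | _ | _, j⟩ <;> simp_all

lemma WellFormed.update (hc : WellFormed c) : WellFormed (update k c b) := by
  intro v
  have h := hc v
  unfold RumorSpreading.update
  rcases hv : c v with ⟨_ | _ | _, j⟩
  · by_cases hb : b v <;> simp_all
  · by_cases hj : j < k <;> simp_all [Nat.not_lt.2]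
  · simp

lemma wellFormed_initial (v₀ : V) : WellFormed (initial v₀) := by
  intro v
  by_cases h : v = v₀ <;> simp [initial, h]

lemma fresh_initial (v₀ : V) : Fresh (initial v₀) v₀ := by
  simp [Fresh, initial]

lemma unc_initial {v₀ v : V} (h : v ≠ v₀) : Unc (initial v₀) v := by
  simp [Unc, initial, h]

/-- Some node of the clique of `x` is colored. -/
def Touched (π : V → W) (c : Config V) (x : W) : Prop := ∃ v, π v = x ∧ ¬ Unc c v

lemma Touched.update {x : W} (h : Touched π c x) : Touched π (update k c b) x := by
  obtain ⟨v, hv, hu⟩ := h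
  exact ⟨v, hv, fun h => hu (unc_update_iff.1 h).1⟩

/-- All colored nodes of the clique of `x` became red in the last round. -/
def FreshClique (π : V → W) (c : Config V) (x : W) : Prop :=
  Touched π c x ∧ ∀ v, π v = x → Unc c v ∨ Fresh c v

/-- All nodes of the clique of `x` are colored. -/
def FullClique (π : V → W) (c : Config V) (x : W) : Prop := ∀ v, π v = x → ¬ Unc c v

lemma FullClique.update {x : W} (h : FullClique π c x) :
    FullClique π (RumorSpreading.update k c b) x :=
  fun v hv hu => h v hv (unc_update_iff.1 hu).1

lemma WellFormed.unc_or_fresh_update (hc : WellFormed c) {v : V} (h : Unc c v) :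
    Unc (RumorSpreading.update k c b) v ∨ Fresh (RumorSpreading.update k c b) v := by
  by_cases hb : b v = true
  · exact Or.inr (hc.fresh_update h hb)
  · exact Or.inl (unc_update_iff.2 ⟨h, by simpa using hb⟩)

lemma WellFormed.freshClique_update (hc : WellFormed c) {x : W} (h : ¬ Touched π c x)
    (h' : Touched π (RumorSpreading.update k c b) x) :
    FreshClique π (RumorSpreading.update k c b) x := by
  refine ⟨h', fun v hv => hc.unc_or_fresh_update ?_⟩
  by_contra hu
  exact h ⟨v, hv, hu⟩

/-- The cliques with a colored node. -/
def touchedSet [Fintype W] (π : V → W) (c : Config V) : Finset W :=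
  Finset.univ.filter (Touched π c)

@[simp] lemma mem_touchedSet [Fintype W] {x : W} : x ∈ touchedSet π c ↔ Touched π c x := by
  simp [touchedSet]

lemma touchedSet_subset_update [Fintype W] : touchedSet π c ⊆ touchedSet π (update k c b) :=
  fun x hx => by
    rw [mem_touchedSet] at hx ⊢
    exact hx.update

lemma card_touchedSet_update_le [Fintype W] (b : V → Bool) :
    ((touchedSet π (update k c b)).card : ℝ) ≤ (touchedSet π c).card +
      (touchedSet π (update k c b) \ touchedSet π c).card := by
  have h := Finset.card_sdiff_add_card_eq_card (touchedSet_subset_update (π := π) (c := c)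
    (b := b) (k := k))
  have h' : ((touchedSet π (update k c b)).card : ℝ) =
      (touchedSet π (update k c b) \ touchedSet π c).card + (touchedSet π c).card := by
    exact_mod_cast h.symm
  linarith

/-- The nodes of `U` that became red in the last round. -/
def freshIn (c : Config V) (U : Finset V) : Finset V := U.filter (Fresh c)

/-- A condition on the color and the counter of `v` under which `v` is orange after `j` rounds. -/
def OrangeWithin (k j : ℕ) (c : Config V) (v : V) : Prop :=
  (c v).1 = Color.orange ∨ ((c v).1 = Color.red ∧ 1 ≤ j ∧ k + 1 ≤ (c v).2 + j)

lemma OrangeWithin.update {j : ℕ} {v : V} (h : OrangeWithin k (j + 1) c v) :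
    OrangeWithin k j (update k c b) v := by
  unfold OrangeWithin RumorSpreading.update at *
  rcases hv : c v with ⟨_ | _ | _, i⟩
  · simp [hv] at h
  · by_cases hi : i < k
    · simp only [hv] at h
      simp only [hi, if_true]
      right
      simp at h ⊢
      omega
    · simp [hi]
  · simp

lemma WellFormed.orangeWithin (hc : WellFormed c) (hk : 1 ≤ k) {v : V} (h : ¬ Unc c v) :
    OrangeWithin k k c v := by
  have h1 := (hc v).2
  unfold Unc at h
  unfold OrangeWithin
  rcases hv : c v with ⟨_ | _ | _, i⟩
  · simp [hv] at h
  · simp only [hv] at h1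
    have := h1 trivial
    right
    simp
    omega
  · simp

lemma orange_update {v : V} (h : (c v).1 = Color.orange) : (update k c b v).1 = Color.orange := by
  unfold update
  rcases hv : c v with ⟨_ | _ | _, i⟩ <;> simp_all

lemma orangeFractionGE_update [Fintype V] {α : ℝ} (h : c ∈ orangeFractionGE (V := V) α) :
    update k c b ∈ orangeFractionGE (V := V) α := by
  refine le_trans (α := ℝ) h ?_
  have hsub : {v | (c v).1 = Color.orange} ⊆ {v | (update k c b v).1 = Color.orange} :=
    fun v hv => orange_update hv
  exact_mod_cast Set.ncard_le_ncard hsub (Set.toFinite _)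

lemma hitProb_orange_eq_one [Fintype V] (G : SimpleGraph V) {α : ℝ} (S : Finset V)
    (hS : α * Fintype.card V ≤ S.card) (j : ℕ) (c : Config V)
    (h : ∀ v ∈ S, OrangeWithin k j c v) : hitProb G k (orangeFractionGE α) j c = 1 := by
  induction j generalizing c with
  | zero =>
    have : c ∈ orangeFractionGE (V := V) α := by
      refine hS.trans ?_
      rw [← Set.ncard_coe_finset]
      refine Nat.cast_le.2 (Set.ncard_le_ncard (fun v hv => ?_) (Set.toFinite _))
      simpa [OrangeWithin] using h v hv
    simp [hitProb, this]
  | succ j ih =>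
    simp only [hitProb, ih _ fun v hv => (h v hv).update, coinExp_const]

end Configurations

/-! ### Bounds for one round -/

section Round

variable {V W : Type*} [Fintype V] {H : SimpleGraph W} {L d k : ℕ} {G : SimpleGraph V}
  {π : V → W} {c : Config V}

lemma stayProb_le_pow (G : SimpleGraph V) {v : V} {R : Finset V} {s : ℝ}
    (hR : ∀ w ∈ R, G.Adj v w ∧ Fresh c w ∧ 2 * s ≤ similarity G v w) :
    stayProb G c v ≤ (1 - s) ^ R.card := by
  have key : ∀ w, G.Adj v w → similarity G v w / 2 ^ (c w).2 ≤ 1 := fun w h =>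
    div_le_one_of_le₀ ((similarity_le_one G h).trans (one_le_pow₀ (by norm_num))) (by positivity)
  have key' : ∀ w, 0 ≤ similarity G v w / 2 ^ (c w).2 := fun w =>
    div_nonneg (similarity_nonneg G v w) (by positivity)
  have hsub : R ⊆ Finset.univ.filter (fun w => G.Adj v w ∧ (c w).1 = Color.red) := by
    intro w hw
    obtain ⟨h1, h2, -⟩ := hR w hw
    unfold Fresh at h2
    simp [h1, h2]
  unfold stayProb
  rw [← Finset.prod_sdiff hsub, ← Finset.prod_const]
  have h1 : ∏ w ∈ R, (1 - similarity G v w / 2 ^ (c w).2) ≤ ∏ _w ∈ R, (1 - s) := by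
    refine Finset.prod_le_prod (fun w hw => by linarith [key w (hR w hw).1]) fun w hw => ?_
    obtain ⟨-, h2, h3⟩ := hR w hw
    unfold Fresh at h2
    rw [h2]
    simp only [pow_one]
    linarith
  have h0 : 0 ≤ ∏ w ∈ R, (1 - similarity G v w / 2 ^ (c w).2) :=
    Finset.prod_nonneg fun w hw => by linarith [key w (hR w hw).1]
  refine (mul_le_of_le_one_left h0 (Finset.prod_le_one (fun w hw => ?_) fun w hw => ?_)).trans h1
  · have hw' := (Finset.mem_filter.1 (Finset.mem_sdiff.1 hw).1).2.1
    linarith [key w hw']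
  · linarith [key' w]

lemma stayProb_le_exp (G : SimpleGraph V) {v : V} {R : Finset V} {s : ℝ}
    (hR : ∀ w ∈ R, G.Adj v w ∧ Fresh c w ∧ 2 * s ≤ similarity G v w) :
    stayProb G c v ≤ Real.exp (-(s * R.card)) := by
  refine (stayProb_le_pow G hR).trans ?_
  rcases R.eq_empty_or_nonempty with rfl | ⟨w, hw⟩
  · simp
  have h1 : 0 ≤ 1 - s := by
    have := (hR w hw).2.2.trans (similarity_le_one G (hR w hw).1)
    linarith
  calc (1 - s) ^ R.card ≤ Real.exp (-s) ^ R.card := by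
        gcongr
        linarith [Real.add_one_le_exp (-s)]
    _ = _ := by
        rw [← Real.exp_nat_mul]
        ring_nf

namespace IsCliqueReplacement

/-- An uncolored node in a clique with a fresh node is informed with constant probability. -/
lemma informProb_ge (hG : IsCliqueReplacement H L d G π) {p₀ : ℝ}
    (hp : 2 * p₀ ≤ (L : ℝ) / (L + 2 * d)) {v w : V} (hvw : π v = π w) (hv : Unc c v)
    (hw : Fresh c w) : p₀ ≤ informProb G c v := by
  have hne : v ≠ w := by
    rintro rfl
    exact hw.not_unc hv
  have hadj := hG.clique v w hvw hne
  have h := stayProb_le_pow (c := c) G (v := v) (R := {w}) (s := p₀) (by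
    intro x hx
    rw [Finset.mem_singleton.1 hx]
    exact ⟨hadj, hw, hp.trans (hG.similarity_ge_of_same hvw hadj)⟩)
  simp only [Finset.card_singleton, pow_one] at h
  unfold informProb
  linarith

/-- The probability that no node of the clique of `y` is informed from outside decays exponentially
in the number of fresh nodes that reach this clique. -/
lemma prod_stayProb_le (hG : IsCliqueReplacement H L d G π) {s : ℝ} (hs₀ : 0 ≤ s)
    (hs : 2 * s ≤ 1 / ((L : ℝ) + d)) {R : Finset V} (hR : ∀ w ∈ R, Fresh c w) (y : W) :
    ∏ v ∈ superNode π y, stayProb G c v ≤ Real.exp (-(s * reachCount G π R y)) := by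
  let Rv : V → Finset V := fun v => R.filter fun w => G.Adj v w
  have h1 : ∀ v ∈ superNode π y, stayProb G c v ≤ Real.exp (-(s * (Rv v).card)) := by
    intro v _
    refine stayProb_le_exp G fun w hw => ?_
    obtain ⟨hw, hadj⟩ := Finset.mem_filter.1 hw
    exact ⟨hadj, hR w hw, hs.trans (hG.similarity_ge_of_ne hadj)⟩
  refine (Finset.prod_le_prod (fun v _ => (stayProb_mem G c v).1) h1).trans ?_
  rw [← Real.exp_sum, Finset.sum_neg_distrib, ← Finset.mul_sum]
  have h2 : reachCount G π R y ≤ ∑ v ∈ superNode π y, (Rv v).card := by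
    refine le_trans (Finset.card_le_card ?_) Finset.card_biUnion_le
    intro w hw
    simp only [Finset.mem_filter] at hw
    obtain ⟨hw, -, v, hv, hadj⟩ := hw
    simp only [Finset.mem_biUnion, mem_superNode]
    exact ⟨v, hv, Finset.mem_filter.2 ⟨hw, hadj.symm⟩⟩
  have h3 : (reachCount G π R y : ℝ) ≤ ∑ v ∈ superNode π y, ((Rv v).card : ℝ) := by
    exact_mod_cast h2
  gcongr

end IsCliqueReplacement

/-! ### Progress inside the cliques -/

/-- Every touched clique is fresh, or has at least `q` fresh nodes, or is full. -/
def Healthy (π : V → W) (q : ℝ) (c : Config V) : Prop :=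
  WellFormed c ∧ ∀ x, Touched π c x →
    FreshClique π c x ∨ q ≤ (freshIn c (superNode π x)).card ∨ FullClique π c x

/-- In the round from `c` to `c'`, the cliques with at least `q` fresh nodes have become full, and
the fresh cliques have become full or have obtained `q` fresh nodes. -/
def Progress (π : V → W) (q : ℝ) (c c' : Config V) : Prop :=
  ∀ x, (q ≤ (freshIn c (superNode π x)).card → FullClique π c' x) ∧
    (FreshClique π c x → q ≤ (freshIn c' (superNode π x)).card ∨ FullClique π c' x)

lemma Healthy.update {q : ℝ} {b : V → Bool} (hc : Healthy π q c)
    (hp : Progress π q c (update k c b)) : Healthy π q (RumorSpreading.update k c b) := by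
  refine ⟨hc.1.update, fun x hx => ?_⟩
  by_cases ht : Touched π c x
  · rcases hc.2 x ht with h | h | h
    · exact Or.inr ((hp x).2 h)
    · exact Or.inr (Or.inr ((hp x).1 h))
    · exact Or.inr (Or.inr h.update)
  · exact Or.inl (hc.1.freshClique_update ht hx)

lemma IsCliqueReplacement.card_unc_add_card_freshIn (hG : IsCliqueReplacement H L d G π) {x : W}
    (hx : FreshClique π c x) :
    ((superNode π x).filter (Unc c)).card + (freshIn c (superNode π x)).card = L := by
  rw [← hG.card_superNode' x, ← Finset.card_filter_add_card_filter_not (s := superNode π x)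
    (Unc c)]
  congr 2
  refine Finset.filter_congr fun v hv => ?_
  exact ⟨fun h => h.not_unc, fun h => (hx.2 v (mem_superNode.1 hv)).resolve_left h⟩

lemma IsCliqueReplacement.coinProb_not_progress_le [Fintype W]
    (hG : IsCliqueReplacement H L d G π) {p₀ : ℝ} (hp₀ : 0 < p₀) (hp₁ : p₀ ≤ 1)
    (hp : 2 * p₀ ≤ (L : ℝ) / (L + 2 * d)) (hc : WellFormed c) :
    coinProb (informProb G c) (fun b => ¬ Progress π (p₀ * L / 8) c (update k c b)) ≤
      (Fintype.card V + Fintype.card W) * Real.exp (-(p₀ ^ 2 * L / 8)) := by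
  set q : ℝ := p₀ * L / 8 with hq
  have hm := informProb_mem G c
  have hq0 : 0 ≤ q := by positivity
  let P₁ : V → (V → Bool) → Prop := fun v b =>
    Unc c v ∧ q ≤ (freshIn c (superNode π (π v))).card ∧ b v = false
  let P₂ : W → (V → Bool) → Prop := fun x b =>
    FreshClique π c x ∧ ¬ q ≤ (freshIn c (superNode π x)).card ∧
      ((((superNode π x).filter (Unc c)).filter fun v => b v = true).card : ℝ) ≤
        p₀ * ((superNode π x).filter (Unc c)).card / 4
  have hcover : ∀ b, ¬ Progress π q c (update k c b) →
      (∃ v ∈ Finset.univ, P₁ v b) ∨ ∃ x ∈ Finset.univ, P₂ x b := by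
    intro b hb
    by_contra hcon
    push Not at hcon
    obtain ⟨h1, h2⟩ := hcon
    have hfull : ∀ x, q ≤ (freshIn c (superNode π x)).card → FullClique π (update k c b) x := by
      intro x hx v hv hu
      rw [unc_update_iff] at hu
      exact h1 v (Finset.mem_univ _) ⟨hu.1, hv ▸ hx, hu.2⟩
    refine hb fun x => ⟨hfull x, fun hx => ?_⟩
    by_cases hxq : q ≤ (freshIn c (superNode π x)).card
    · exact Or.inr (hfull x hxq)
    left
    have h3 : ¬ (_ ≤ _) := fun h => h2 x (Finset.mem_univ _) ⟨hx, hxq, h⟩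
    push Not at h3 hxq
    have h4 := hG.card_unc_add_card_freshIn hx
    have h4' : (((superNode π x).filter (Unc c)).card : ℝ) +
        (freshIn c (superNode π x)).card = L := by exact_mod_cast h4
    have h5 : (L : ℝ) / 2 ≤ ((superNode π x).filter (Unc c)).card := by
      have : p₀ * L ≤ 1 * L := by gcongr
      linarith
    have h6 : (((superNode π x).filter (Unc c)).filter fun v => b v = true).card ≤
        (freshIn (update k c b) (superNode π x)).card := by
      refine Finset.card_le_card fun v hv => ?_
      simp only [Finset.mem_filter] at hv
      exact Finset.mem_filter.2 ⟨hv.1.1, hc.fresh_update hv.1.2 hv.2⟩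
    have h6' : ((((superNode π x).filter (Unc c)).filter fun v => b v = true).card : ℝ) ≤
        (freshIn (update k c b) (superNode π x)).card := by exact_mod_cast h6
    have h7 : p₀ * (L / 2) ≤ p₀ * ((superNode π x).filter (Unc c)).card := by gcongr
    linarith
  have hP₁ : ∀ v ∈ Finset.univ, coinProb (informProb G c) (P₁ v) ≤
      Real.exp (-(p₀ ^ 2 * L / 8)) := by
    intro v _
    by_cases h : Unc c v ∧ q ≤ (freshIn c (superNode π (π v))).card
    · refine (coinProb_mono hm (Q := fun b => ∀ w ∈ ({v} : Finset V), b w = false)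
        fun b hb w hw => ?_).trans ?_
      · rw [Finset.mem_singleton.1 hw]
        exact hb.2.2
      · rw [coinProb_forall_false, Finset.prod_singleton]
        have hst := stayProb_le_exp (c := c) G (v := v) (R := freshIn c (superNode π (π v)))
          (s := p₀) (by
            intro w hw
            simp only [freshIn, Finset.mem_filter, mem_superNode] at hw
            have hne : v ≠ w := by
              rintro rfl
              exact hw.2.not_unc h.1
            have hadj := hG.clique v w hw.1.symm hne
            exact ⟨hadj, hw.2, hp.trans (hG.similarity_ge_of_same hw.1.symm hadj)⟩)
        have : 1 - informProb G c v = stayProb G c v := by simp [informProb]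
        rw [this]
        refine hst.trans (Real.exp_le_exp.2 ?_)
        have := mul_le_mul_of_nonneg_left h.2 hp₀.le
        have : p₀ * q = p₀ ^ 2 * L / 8 := by rw [hq]; ring
        linarith
    · refine (coinProb_mono hm (Q := fun _ => False) fun b hb => h ⟨hb.1, hb.2.1⟩).trans ?_
      simpa [coinProb, coinExp_const] using (Real.exp_pos _).le
  have hP₂ : ∀ x ∈ Finset.univ, coinProb (informProb G c) (P₂ x) ≤
      Real.exp (-(p₀ ^ 2 * L / 8)) := by
    intro x _
    by_cases h : FreshClique π c x ∧ ¬ q ≤ (freshIn c (superNode π x)).card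
    · obtain ⟨hx, hxq⟩ := h
      refine (coinProb_mono hm fun b hb => hb.2.2).trans
        ((coinProb_card_le hm _ fun v hv => ?_).trans ?_)
      · simp only [Finset.mem_filter, mem_superNode] at hv
        obtain ⟨w, hw, hwu⟩ := hx.1
        exact hG.informProb_ge hp (hv.1.trans hw.symm) hv.2 ((hx.2 w hw).resolve_left hwu)
      · push Not at hxq
        have h4 := hG.card_unc_add_card_freshIn hx
        have h4' : (((superNode π x).filter (Unc c)).card : ℝ) +
            (freshIn c (superNode π x)).card = L := by exact_mod_cast h4
        have h8 : p₀ * L ≤ 1 * L := by gcongr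
        have h5 : (L : ℝ) / 2 ≤ ((superNode π x).filter (Unc c)).card := by
          linarith
        have h7 : p₀ * (L / 2) ≤ p₀ * ((superNode π x).filter (Unc c)).card := by gcongr
        have h9 : p₀ * (p₀ * L) ≤ p₀ * (1 * L) := by gcongr
        refine Real.exp_le_exp.2 ?_
        nlinarith
    · refine (coinProb_mono hm (Q := fun _ => False) fun b hb => h ⟨hb.1, hb.2.1⟩).trans ?_
      simpa [coinProb, coinExp_const] using (Real.exp_pos _).le
  refine (coinProb_mono hm hcover).trans ((coinProb_or_le hm _ _).trans ?_)
  rw [add_mul]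
  refine add_le_add ((coinProb_exists_le hm _ _).trans ?_) ((coinProb_exists_le hm _ _).trans ?_)
  · refine (Finset.sum_le_card_nsmul _ _ _ hP₁).trans (le_of_eq ?_)
    simp
  · refine (Finset.sum_le_card_nsmul _ _ _ hP₂).trans (le_of_eq ?_)
    simp

end Round

/-! ### Expansion -/

/-- A consequence of the Cauchy-Schwarz inequality and `1 - exp (-x) ≥ x / (1 + x)`. -/
lemma sq_div_le_sum_one_sub_exp {ι : Type*} (Y : Finset ι) (x : ι → ℝ) (hx : ∀ y ∈ Y, 0 ≤ x y)
    {Z : ℝ} (hZ : 0 < Z) (h : ∑ y ∈ Y, (x y + x y ^ 2) ≤ Z) :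
    (∑ y ∈ Y, x y) ^ 2 / Z ≤ ∑ y ∈ Y, (1 - Real.exp (-x y)) := by
  set X := ∑ y ∈ Y, x y
  set θ := X / Z with hθ
  have hpt : ∀ y ∈ Y, 2 * θ * x y - θ ^ 2 * (x y + x y ^ 2) ≤ 1 - Real.exp (-x y) := by
    intro y hy
    have h0 := hx y hy
    have h1 : Real.exp (-x y) ≤ 1 / (1 + x y) := by
      rw [Real.exp_neg, ← one_div]
      exact one_div_le_one_div_of_le (by linarith) (by linarith [Real.add_one_le_exp (x y)])
    have h2 : 1 - 1 / (1 + x y) - (2 * θ * x y - θ ^ 2 * (x y + x y ^ 2)) =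
        x y / (1 + x y) * (1 - θ * (1 + x y)) ^ 2 := by
      have : 1 + x y ≠ 0 := by linarith
      field_simp
      ring
    have h3 : 0 ≤ x y / (1 + x y) * (1 - θ * (1 + x y)) ^ 2 := by positivity
    linarith
  refine le_trans ?_ (Finset.sum_le_sum hpt)
  rw [Finset.sum_sub_distrib, ← Finset.mul_sum, ← Finset.mul_sum]
  have h1 : θ ^ 2 * ∑ y ∈ Y, (x y + x y ^ 2) ≤ θ ^ 2 * Z := by gcongr
  have h2 : X ^ 2 / Z = 2 * θ * X - θ ^ 2 * Z := by
    rw [hθ]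
    field_simp
    ring
  rw [h2]
  linarith

section Expansion

variable {V W : Type*} [Fintype W] {H : SimpleGraph W} {L d k : ℕ} {G : SimpleGraph V}
  {π : V → W} {C : ℝ}

/-- The variance bound for the numbers of neighbors in a set, for a regular graph of degree `D`. -/
def SmallVariance (H : SimpleGraph W) (D : ℕ) (C : ℝ) : Prop :=
  ∀ A : Finset W, ∑ y, ((nbrCount H A y : ℝ) - D * A.card / Fintype.card W) ^ 2 ≤
    C ^ 2 * D * A.card

lemma smallVariance {D : ℕ} (hH : H.IsRegularOfDegree D) (hl : secondEigenvalue H ≤ C * √(D : ℝ))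
    (hlD : C * √(D : ℝ) < D) : SmallVariance H D C := by
  intro A
  refine (sum_nbrCount_sub_sq_le hH hl hlD A).trans (le_of_eq ?_)
  rw [mul_pow, Real.sq_sqrt (by positivity)]

variable {D : ℕ}

lemma sum_nbrCount_sq_le [Nonempty W] (hH : H.IsRegularOfDegree D) (hV : SmallVariance H D C)
    (A : Finset W) :
    ∑ y, (nbrCount H A y : ℝ) ^ 2 ≤
      (D * A.card : ℝ) ^ 2 / Fintype.card W + C ^ 2 * D * A.card := by
  have hN : (0 : ℝ) < Fintype.card W := by exact_mod_cast Fintype.card_pos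
  set m : ℝ := D * A.card / Fintype.card W with hm
  have hsum : ∑ y, (nbrCount H A y : ℝ) = D * A.card := by exact_mod_cast sum_nbrCount hH A
  have h1 : ∀ y, (nbrCount H A y : ℝ) ^ 2 =
      ((nbrCount H A y : ℝ) - m) ^ 2 + (2 * m * nbrCount H A y - m ^ 2) := fun y => by ring
  rw [Finset.sum_congr rfl fun y _ => h1 y, Finset.sum_add_distrib, Finset.sum_sub_distrib,
    ← Finset.mul_sum, hsum, Finset.sum_const, Finset.card_univ, nsmul_eq_mul]
  have h2 : 2 * m * (D * A.card) - Fintype.card W * m ^ 2 =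
      (D * A.card : ℝ) ^ 2 / Fintype.card W := by
    rw [hm]
    field_simp
    ring
  rw [h2]
  linarith [hV A]

lemma sum_nbrCount_le [Nonempty W] (hV : SmallVariance H D C) {A I : Finset W} {ρ : ℝ}
    (hρ : 0 ≤ ρ) (hI : 4 * I.card ≤ ρ * Fintype.card W)
    (hI' : 16 * C ^ 2 * I.card ≤ ρ ^ 2 * (D * A.card)) :
    ∑ y ∈ I, (nbrCount H A y : ℝ) ≤ ρ / 2 * (D * A.card) := by
  have hN : (0 : ℝ) < Fintype.card W := by exact_mod_cast Fintype.card_pos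
  set m : ℝ := D * A.card / Fintype.card W with hm
  have h1 : (∑ y ∈ I, ((nbrCount H A y : ℝ) - m)) ^ 2 ≤ (ρ / 4 * (D * A.card)) ^ 2 := by
    have h2 : (∑ y ∈ I, ((nbrCount H A y : ℝ) - m) ^ 2) ≤ C ^ 2 * D * A.card :=
      (Finset.sum_le_sum_of_subset_of_nonneg (Finset.subset_univ I)
        fun _ _ _ => sq_nonneg _).trans (hV A)
    calc _ ≤ (I.card : ℝ) * ∑ y ∈ I, ((nbrCount H A y : ℝ) - m) ^ 2 := sq_sum_le_card_mul_sum_sq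
      _ ≤ I.card * (C ^ 2 * D * A.card) := by gcongr
      _ = (16 * C ^ 2 * I.card) * (D * A.card) / 16 := by ring
      _ ≤ (ρ ^ 2 * (D * A.card)) * (D * A.card) / 16 := by gcongr
      _ = _ := by ring
  have h3 := abs_le_of_sq_le_sq h1 (by positivity)
  have h4 := (le_abs_self _).trans h3
  rw [Finset.sum_sub_distrib, Finset.sum_const, nsmul_eq_mul] at h4
  have h5 : (I.card : ℝ) * m ≤ ρ / 4 * (D * A.card) := by
    rw [hm, mul_div_assoc', div_le_iff₀ hN]
    have : (I.card : ℝ) * 4 * (D * A.card) ≤ ρ * Fintype.card W * (D * A.card) :=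
      mul_le_mul_of_nonneg_right (by linarith) (by positivity)
    linarith
  linarith

/-- Most cliques are reached by a fair share of the edges that leave a large set `A`. -/
lemma card_nbrCount_lt_le [Nonempty W] (hV : SmallVariance H D C) (hD : 0 < D) {A : Finset W}
    {a : ℝ} (ha : 0 < a) (hA : a * Fintype.card W ≤ A.card) :
    ((Finset.univ.filter fun y => (nbrCount H A y : ℝ) < D * a / 2).card : ℝ) ≤
      4 * C ^ 2 / (a * D) * Fintype.card W := by
  have hN : (0 : ℝ) < Fintype.card W := by exact_mod_cast Fintype.card_pos
  have hD' : (0 : ℝ) < D := by exact_mod_cast hD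
  have hA0 : (0 : ℝ) < A.card := lt_of_lt_of_le (by positivity) hA
  set m : ℝ := D * A.card / Fintype.card W with hm
  have hm1 : D * a ≤ m := by
    rw [hm, le_div_iff₀ hN, mul_assoc]
    gcongr
  set B := Finset.univ.filter fun y => (nbrCount H A y : ℝ) < D * a / 2
  have h1 : (B.card : ℝ) * (m / 2) ^ 2 ≤ C ^ 2 * D * A.card := by
    refine le_trans ?_ (hV A)
    refine le_trans ?_ (Finset.sum_le_sum_of_subset_of_nonneg (Finset.subset_univ B)
        fun _ _ _ => sq_nonneg _)
    rw [← nsmul_eq_mul]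
    refine Finset.card_nsmul_le_sum _ _ _ fun y hy => ?_
    have hy := (Finset.mem_filter.1 hy).2
    have h0 : 0 ≤ m / 2 := by positivity
    rw [← neg_sq ((nbrCount H A y : ℝ) - _)]
    refine pow_le_pow_left₀ h0 ?_ 2
    linarith
  have h2 : (B.card : ℝ) * (D * A.card) ≤ 4 * C ^ 2 * (Fintype.card W) ^ 2 := by
    have h3 : (B.card : ℝ) * (m / 2) ^ 2 =
        (B.card : ℝ) * (D * A.card) / (4 * Fintype.card W ^ 2) * (D * A.card) := by
      rw [hm]
      field_simp
      ring
    rw [h3] at h1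
    have h4 : (B.card : ℝ) * (D * A.card) / (4 * Fintype.card W ^ 2) ≤ C ^ 2 := by
      refine le_of_mul_le_mul_right (h1.trans (le_of_eq (by ring))) (show (0 : ℝ) < D * A.card by
        positivity)
    rw [div_le_iff₀ (by positivity)] at h4
    linarith
  have h5 : (B.card : ℝ) * (D * (a * Fintype.card W)) ≤ (B.card : ℝ) * (D * A.card) := by gcongr
  rw [div_mul_eq_mul_div, le_div_iff₀ (by positivity)]
  refine le_of_mul_le_mul_right ?_ hN
  linarith

variable [Fintype V]

/-- The constant in the expansion of the process, in terms of the density `ρ` of the transmitting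
nodes and the strength `σ` of the edges between cliques. -/
def growthConst (ρ σ : ℝ) : ℝ := ρ ^ 2 * σ / (4 * (2 + σ))

/-- If at least a fraction `ρ` of the nodes over `A` transmit along their edges to other cliques,
then the expected number of cliques hit outside of a small set `I` is at least proportional to
`min (d * |A|) |W|`.  The cliques in `I` absorb at most half of the edges, and the second moment of
the numbers of edges is too small for the remaining ones to concentrate on few cliques. -/
lemma IsCliqueReplacement.le_sum_one_sub_exp [Nonempty W] (hG : IsCliqueReplacement H L d G π)
    (hH : H.IsRegularOfDegree (d * L)) (hV : SmallVariance H (d * L) C) (hL : 0 < L)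
    {ρ σ : ℝ} (hρ : 0 ≤ ρ) (hσ : 0 < σ) (hσL : σ * C ^ 2 ≤ L) {A I : Finset W} {R : Finset V}
    (hRA : ∀ w ∈ R, π w ∈ A) (hR : ρ * (L * A.card) ≤ R.card)
    (hI : 4 * I.card ≤ ρ * Fintype.card W)
    (hI' : 16 * C ^ 2 * I.card ≤ ρ ^ 2 * ((d * L : ℕ) * A.card)) :
    growthConst ρ σ * min (d * A.card : ℝ) (Fintype.card W) ≤
      ∑ y ∈ Finset.univ \ I, (1 - Real.exp (-(σ / L * reachCount G π R y))) := by
  have hN : (0 : ℝ) < Fintype.card W := by exact_mod_cast Fintype.card_pos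
  have hL' : (0 : ℝ) < L := by exact_mod_cast hL
  set N : ℝ := (Fintype.card W : ℝ)
  set a : ℝ := d * A.card with ha
  have ha0 : 0 ≤ a := by positivity
  rcases ha0.eq_or_lt with ha0 | ha0
  · rw [← ha0, min_eq_left hN.le, mul_zero]
    refine Finset.sum_nonneg fun y _ => ?_
    have : Real.exp (-(σ / L * reachCount G π R y)) ≤ 1 :=
      Real.exp_le_one_iff.2 (neg_nonpos.2 (by positivity))
    linarith
  have hle : ∀ y, (reachCount G π R y : ℝ) ≤ nbrCount H A y := fun y => by
    exact_mod_cast hG.reachCount_le_nbrCount hRA y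
  have hsumR : ∑ y, (reachCount G π R y : ℝ) = d * R.card := by
    exact_mod_cast hG.sum_reachCount R
  have hsumA : ∑ y, (nbrCount H A y : ℝ) = L * a := by
    have := sum_nbrCount hH A
    rw [ha]
    have h' : ((∑ y, nbrCount H A y : ℕ) : ℝ) = ((d * L * A.card : ℕ) : ℝ) := by rw [this]
    push_cast at h'
    linarith
  have hDA : (((d * L : ℕ) : ℝ) * A.card) = L * a := by
    rw [ha]
    push_cast
    ring
  have hsplit : ∑ y ∈ Finset.univ \ I, (reachCount G π R y : ℝ) +
      ∑ y ∈ I, (reachCount G π R y : ℝ) = d * R.card := by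
    rw [Finset.sum_sdiff (Finset.subset_univ I), hsumR]
  have hIn : ∑ y ∈ I, (reachCount G π R y : ℝ) ≤ ρ / 2 * (L * a) := by
    rw [← hDA]
    exact (Finset.sum_le_sum fun y _ => hle y).trans (sum_nbrCount_le hV hρ hI hI')
  have hX : ρ / 2 * (L * a) ≤ ∑ y ∈ Finset.univ \ I, (reachCount G π R y : ℝ) := by
    have : d * (ρ * (L * A.card)) ≤ (d : ℝ) * R.card := by gcongr
    have h2 : d * (ρ * (L * A.card)) = ρ * (L * a) := by
      rw [ha]
      ring
    linarith
  have hX1 : ∑ y ∈ Finset.univ \ I, (reachCount G π R y : ℝ) ≤ L * a := by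
    rw [← hsumA]
    exact (Finset.sum_le_sum fun y _ => hle y).trans
      (Finset.sum_le_sum_of_subset_of_nonneg (Finset.subset_univ _) fun _ _ _ => by positivity)
  have hX2 : ∑ y ∈ Finset.univ \ I, (reachCount G π R y : ℝ) ^ 2 ≤
      (L * a) ^ 2 / N + C ^ 2 * (L * a) := by
    have h1 := sum_nbrCount_sq_le hH hV A
    rw [mul_assoc, hDA] at h1
    refine le_trans ?_ h1
    refine (Finset.sum_le_sum fun y _ => pow_le_pow_left₀ (by positivity) (hle y) 2).trans
      (Finset.sum_le_sum_of_subset_of_nonneg (Finset.subset_univ _) fun _ _ _ => by positivity)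
  have key := sq_div_le_sum_one_sub_exp (Finset.univ \ I)
    (fun y => σ / L * reachCount G π R y) (fun y _ => by positivity)
    (Z := 2 * σ * a + (σ * a) ^ 2 / N) (by positivity) (by
      simp_rw [mul_pow]
      rw [Finset.sum_add_distrib, ← Finset.mul_sum, ← Finset.mul_sum]
      have h1 : σ / L * ∑ y ∈ Finset.univ \ I, (reachCount G π R y : ℝ) ≤ σ / L * (L * a) := by
        gcongr
      have h2 : (σ / L) ^ 2 * ∑ y ∈ Finset.univ \ I, (reachCount G π R y : ℝ) ^ 2 ≤
          (σ / L) ^ 2 * ((L * a) ^ 2 / N + C ^ 2 * (L * a)) := by gcongr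
      have h3 : σ / L * (L * a) = σ * a := by field_simp
      have h4 : (σ / L) ^ 2 * ((L * a) ^ 2 / N + C ^ 2 * (L * a)) =
          (σ * a) ^ 2 / N + σ * a * (σ * C ^ 2) / L := by field_simp
      have h5 : σ * a * (σ * C ^ 2) / L ≤ σ * a := by
        rw [div_le_iff₀ hL']
        gcongr
      calc _ ≤ σ * a + ((σ * a) ^ 2 / N + σ * a) :=
            add_le_add (h1.trans h3.le) (h2.trans (h4.le.trans (by gcongr)))
        _ = _ := by ring)
  refine le_trans ?_ key
  rw [← Finset.mul_sum]
  have hXs : σ * ρ * a / 2 ≤ σ / L * ∑ y ∈ Finset.univ \ I, (reachCount G π R y : ℝ) := by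
    have h1 : σ / L * (ρ / 2 * (L * a)) ≤
      σ / L * ∑ y ∈ Finset.univ \ I, (reachCount G π R y : ℝ) := by gcongr
    have h2 : σ / L * (ρ / 2 * (L * a)) = σ * ρ * a / 2 := by field_simp
    linarith
  have h1 : (σ * ρ * a / 2) ^ 2 / (2 * σ * a + (σ * a) ^ 2 / N) ≤
      (σ / L * ∑ y ∈ Finset.univ \ I, (reachCount G π R y : ℝ)) ^ 2 /
        (2 * σ * a + (σ * a) ^ 2 / N) := by gcongr
  refine le_trans ?_ h1
  have h2 : (σ * ρ * a / 2) ^ 2 / (2 * σ * a + (σ * a) ^ 2 / N) =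
      ρ ^ 2 * σ / 4 * (a * N / (2 * N + σ * a)) := by
    field_simp
    ring
  rw [h2]
  have h3 : growthConst ρ σ * min a N = ρ ^ 2 * σ / 4 * (min a N / (2 + σ)) := by
    unfold growthConst
    field_simp
  rw [h3]
  refine mul_le_mul_of_nonneg_left ?_ (by positivity)
  rw [div_le_div_iff₀ (by positivity) (by positivity)]
  rcases le_total a N with h | h
  · rw [min_eq_left h]
    have : σ * a ≤ σ * N := by gcongr
    have : a * (2 * N + σ * a) ≤ a * (2 * N + σ * N) := by gcongr
    linarith
  · rw [min_eq_right h]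
    have : N * (2 * N) ≤ N * (2 * a) := by gcongr
    nlinarith

end Expansion

/-! ### Spreading between the cliques -/

section Spreading

variable {V W : Type*} {H : SimpleGraph W} {L d k : ℕ} {G : SimpleGraph V}
  {π : V → W} {C p₀ σ : ℝ} {c : Config V}

/-- The indicator that no node of the clique of `y` is colored. -/
def untouched (π : V → W) (c : Config V) (y : W) : ℝ := if Touched π c y then 0 else 1

lemma untouched_nonneg (y : W) : 0 ≤ untouched π c y := by
  unfold untouched
  split_ifs <;> norm_num

lemma untouched_le_one (y : W) : untouched π c y ≤ 1 := by
  unfold untouched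
  split_ifs <;> norm_num

lemma untouched_update_le (b : V → Bool) (y : W) :
    untouched π (update k c b) y ≤ untouched π c y := by
  unfold untouched
  by_cases h : Touched π c y
  · simp [h, h.update]
  · simp only [h, if_false]
    split_ifs <;> norm_num

/-- The nodes of the cliques in `A`. -/
def nodesOver [Fintype V] (π : V → W) (A : Finset W) : Finset V :=
  Finset.univ.filter fun w => π w ∈ A

lemma IsCliqueReplacement.card_nodesOver [Fintype V]
    (hG : IsCliqueReplacement H L d G π) (A : Finset W) :
    (nodesOver π A).card = L * A.card := by
  unfold nodesOver
  rw [Finset.card_eq_sum_card_fiberwise (f := π) (t := A) (fun v hv => by simpa using hv)]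
  rw [Finset.sum_congr rfl fun x hx => (?_ : _ = L)]
  · simp [mul_comm]
  · rw [← hG.card_superNode' x]
    congr 1
    ext v
    simp only [Finset.mem_filter, Finset.mem_univ, true_and, mem_superNode]
    exact ⟨fun h => h.2, fun h => ⟨h ▸ hx, h⟩⟩

variable [Fintype W]

/-- The properties of an expander of cliques on which the upper bound for the spreading time rests:
expansion, the probability `p₀` of being informed inside a fresh clique, and the strength `σ / L`
of the edges between cliques. -/
structure ExpanderData (H : SimpleGraph W) (L d : ℕ) (G : SimpleGraph V) (π : V → W)
    (C p₀ σ : ℝ) : Prop where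
  nonempty : Nonempty W
  isCliqueReplacement : IsCliqueReplacement H L d G π
  isRegularOfDegree : H.IsRegularOfDegree (d * L)
  smallVariance : SmallVariance H (d * L) C
  L_pos : 0 < L
  d_pos : 0 < d
  p₀_pos : 0 < p₀
  p₀_le : p₀ ≤ 1
  two_mul_p₀_le : 2 * p₀ ≤ (L : ℝ) / (L + 2 * d)
  σ_pos : 0 < σ
  two_mul_σ_le : 2 * (σ / L) ≤ 1 / ((L : ℝ) + d)
  σ_mul_le : σ * C ^ 2 ≤ L

namespace ExpanderData

lemma growthConst_pos (hD : ExpanderData H L d G π C p₀ σ) : 0 < growthConst (p₀ / 8) σ := by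
  have := hD.p₀_pos
  have := hD.σ_pos
  unfold growthConst
  positivity

lemma growthConst_le (hD : ExpanderData H L d G π C p₀ σ) :
    growthConst (p₀ / 8) σ ≤ p₀ / 8 / 4 := by
  have h0 := hD.p₀_pos
  have h1 := hD.p₀_le
  have h2 := hD.σ_pos
  unfold growthConst
  rw [div_le_iff₀ (by positivity)]
  have : p₀ / 8 * (p₀ / 8) ≤ p₀ / 8 * 1 := by gcongr; linarith
  have : (p₀ / 8 * (p₀ / 8)) * σ ≤ (p₀ / 8 * 1) * σ := by gcongr
  nlinarith

variable [Fintype V]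

/-- If at least a fraction `ρ` of the nodes of the cliques in `A` is fresh, then the number of newly
touched cliques is at least proportional to `min (d * |A|) |W|`. -/
lemma coinProb_card_newly_touched_le (hD : ExpanderData H L d G π C p₀ σ)
    {A : Finset W} {R : Finset V} {ρ μ : ℝ} (hρ : 0 ≤ ρ)
    (hRc : ∀ w ∈ R, Fresh c w) (hRA : ∀ w ∈ R, π w ∈ A) (hR : ρ * (L * A.card) ≤ R.card)
    (hI : 4 * (touchedSet π c).card ≤ ρ * Fintype.card W)
    (hI' : 16 * C ^ 2 * (touchedSet π c).card ≤ ρ ^ 2 * ((d * L : ℕ) * A.card))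
    (hμ : μ ≤ growthConst ρ σ * min (d * A.card : ℝ) (Fintype.card W)) :
    coinProb (informProb G c)
        (fun b => ((touchedSet π (update k c b) \ touchedSet π c).card : ℝ) ≤ μ / 4) ≤
      Real.exp (-(μ / 4)) := by
  have := hD.nonempty
  have hL : (0 : ℝ) < L := by exact_mod_cast hD.L_pos
  have hm := informProb_mem G c
  have key := coinProb_card_blocks_le hm (Finset.univ \ touchedSet π c) (superNode π)
    (m := μ) (fun x _ y _ hxy => by
      refine Finset.disjoint_left.2 fun v hv hv' => hxy ?_
      rw [← mem_superNode.1 hv, ← mem_superNode.1 hv']) (by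
      refine hμ.trans ((hD.isCliqueReplacement.le_sum_one_sub_exp hD.isRegularOfDegree
        hD.smallVariance hD.L_pos hρ hD.σ_pos hD.σ_mul_le hRA hR hI hI').trans ?_)
      refine Finset.sum_le_sum fun y _ => ?_
      have h := hD.isCliqueReplacement.prod_stayProb_le (s := σ / L)
        (div_nonneg hD.σ_pos.le hL.le) hD.two_mul_σ_le hRc y
      simp only [informProb, sub_sub_cancel]
      linarith)
  refine (coinProb_mono hm fun b hb => ?_).trans key
  refine le_trans ?_ hb
  norm_cast
  refine Finset.card_le_card fun y hy => ?_
  simp only [Finset.mem_filter, Finset.mem_sdiff, Finset.mem_univ, true_and, mem_touchedSet,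
    mem_superNode] at hy ⊢
  obtain ⟨h1, v, hv, hb⟩ := hy
  exact ⟨⟨v, hv, fun hu => by simp [(unc_update_iff.1 hu).2] at hb⟩, h1⟩

/-- If half of the nodes of fresh cliques are uncolored, a constant fraction of the nodes becomes
red in the next round. -/
lemma coinProb_card_freshIn_le (hD : ExpanderData H L d G π C p₀ σ)
    (hc : WellFormed c) {A : Finset W}
    (hA : ∀ x ∈ A, FreshClique π c x)
    (hU : (L * A.card : ℝ) / 2 ≤ ((nodesOver π A).filter (Unc c)).card) :
    coinProb (informProb G c)
        (fun b => ((freshIn (update k c b) (nodesOver π A)).card : ℝ) ≤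
          p₀ / 8 * (L * A.card)) ≤
      Real.exp (-(p₀ / 8 * (L * A.card))) := by
  have hm := informProb_mem G c
  set U := (nodesOver π A).filter (Unc c)
  have h1 : p₀ / 8 * (L * A.card) ≤ p₀ * U.card / 4 := by
    have := mul_le_mul_of_nonneg_left hU hD.p₀_pos.le
    linarith
  refine (coinProb_mono hm fun b hb => ?_).trans ((coinProb_card_le hm U (q := p₀) ?_).trans ?_)
  · refine le_trans ?_ (hb.trans h1)
    norm_cast
    refine Finset.card_le_card fun v hv => ?_
    simp only [U, Finset.mem_filter] at hv
    exact Finset.mem_filter.2 ⟨hv.1.1, hc.fresh_update hv.1.2 hv.2⟩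
  · intro v hv
    simp only [U, nodesOver, Finset.mem_filter, Finset.mem_univ, true_and] at hv
    obtain ⟨⟨w, hw, hwu⟩, hx⟩ := hA _ hv.1
    exact hD.isCliqueReplacement.informProb_ge hD.two_mul_p₀_le hw.symm hv.2
      ((hx w hw).resolve_left hwu)
  · exact Real.exp_le_exp.2 (by linarith)

lemma coinExp_untouched_le (hD : ExpanderData H L d G π C p₀ σ)
    {R : Finset V} (hR : ∀ w ∈ R, Fresh c w) (y : W) :
    coinExp (informProb G c) (fun b => untouched π (update k c b) y) ≤
      Real.exp (-(σ / L * reachCount G π R y)) := by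
  have hL : (0 : ℝ) < L := by exact_mod_cast hD.L_pos
  have hm := informProb_mem G c
  have h := hD.isCliqueReplacement.prod_stayProb_le (s := σ / L)
        (div_nonneg hD.σ_pos.le hL.le) hD.two_mul_σ_le hR y
  refine le_trans (coinExp_mono hm fun b => ?_) (le_trans (le_of_eq
    (coinProb_forall_false (informProb G c) (superNode π y))) (by simpa [informProb] using h))
  split_ifs with hb
  · exact untouched_le_one y
  · push Not at hb
    obtain ⟨v, hv, hb⟩ := hb
    have : Touched π (update k c b) y :=
      ⟨v, mem_superNode.1 hv, fun hu => hb (unc_update_iff.1 hu).2⟩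
    simp [untouched, this]

/-- Two rounds after many cliques `A` were touched for the first time, a clique that receives a
fair share of the edges from `A` is untouched with small probability only.  The nodes that transmit
along these edges are fresh now or have a constant chance to become fresh in the next round. -/
lemma coinExp_coinExp_untouched_le (hD : ExpanderData H L d G π C p₀ σ)
    (hc : WellFormed c) {A : Finset W}
    (hA : ∀ x ∈ A, FreshClique π c x) {M : ℝ} (hM : 0 ≤ M) {y : W}
    (hy : 2 * M ≤ nbrCount H A y) :
    coinExp (informProb G c) (fun b => coinExp (informProb G (update k c b))
        (fun b' => untouched π (update k (update k c b) b') y)) ≤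
      2 * Real.exp (-(σ / L * (p₀ * M / 4))) := by
  have hL : (0 : ℝ) < L := by exact_mod_cast hD.L_pos
  have hσ := hD.σ_pos
  have hp := hD.p₀_pos
  have hm := informProb_mem G c
  set η := Real.exp (-(σ / L * (p₀ * M / 4)))
  have hη : 0 < η := Real.exp_pos _
  set F := freshIn c (nodesOver π A)
  set U := (nodesOver π A).filter (Unc c)
  have hcount : 2 * M ≤ reachCount G π F y + reachCount G π U y := by
    refine hy.trans ?_
    have h1 := hD.isCliqueReplacement.nbrCount_le_reachCount A y
    have h2 : reachCount G π (Finset.univ.filter fun w => π w ∈ A) y ≤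
        reachCount G π F y + reachCount G π U y := by
      unfold reachCount
      refine le_trans (Finset.card_le_card ?_) (Finset.card_union_le _ _)
      intro w hw
      simp only [Finset.mem_filter, Finset.mem_univ, true_and] at hw
      simp only [F, U, freshIn, nodesOver, Finset.mem_union, Finset.mem_filter, Finset.mem_univ,
        true_and]
      rcases (hA _ hw.1).2 w rfl with h | h
      · exact Or.inr ⟨⟨hw.1, h⟩, hw.2⟩
      · exact Or.inl ⟨⟨hw.1, h⟩, hw.2⟩
    exact_mod_cast h1.trans h2
  have hpM : p₀ * M / 4 ≤ M := by
    have : p₀ * M ≤ 1 * M := mul_le_mul_of_nonneg_right hD.p₀_le hM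
    linarith
  by_cases hF : M ≤ reachCount G π F y
  · calc _ ≤ coinExp (informProb G c) (fun b => untouched π (update k c b) y) := by
          refine coinExp_mono hm fun b => ?_
          exact (coinExp_mono (informProb_mem G _) fun b' => untouched_update_le b' y).trans
            (coinExp_const _ _).le
      _ ≤ Real.exp (-(σ / L * reachCount G π F y)) :=
          hD.coinExp_untouched_le (fun w hw => (Finset.mem_filter.1 hw).2) y
      _ ≤ η := by
          refine Real.exp_le_exp.2 (neg_le_neg ?_)
          gcongr
          linarith
      _ ≤ _ := by linarith
  · have hU : M ≤ reachCount G π U y := by linarith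
    set U' := U.filter fun w => Reaches G π w y with hU'
    have hU2 : M ≤ U'.card := hU
    let B : (V → Bool) → Prop := fun b =>
      ((U'.filter fun v => b v = true).card : ℝ) ≤ p₀ * U'.card / 4
    have hB : coinProb (informProb G c) B ≤ η := by
      refine (coinProb_card_le hm U' (q := p₀) ?_).trans ?_
      · intro v hv
        simp only [U', U, nodesOver, Finset.mem_filter, Finset.mem_univ, true_and] at hv
        obtain ⟨⟨w, hw, hwu⟩, hx⟩ := hA _ hv.1.1
        exact hD.isCliqueReplacement.informProb_ge hD.two_mul_p₀_le hw.symm hv.1.2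
          ((hx w hw).resolve_left hwu)
      · refine Real.exp_le_exp.2 (neg_le_neg ?_)
        have h1 : σ / L ≤ 1 := by
          have h2 := hD.two_mul_σ_le
          have h3 : 1 / ((L : ℝ) + d) ≤ 1 := by
            rw [div_le_one (by positivity)]
            have : (1 : ℝ) ≤ L := by exact_mod_cast hD.L_pos
            have : (0 : ℝ) ≤ d := by positivity
            linarith
          have : 0 ≤ σ / L := by positivity
          linarith
        calc σ / L * (p₀ * M / 4) ≤ 1 * (p₀ * M / 4) := by gcongr
          _ = p₀ * M / 4 := one_mul _
          _ ≤ _ := by gcongr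
    have hpt : ∀ b, coinExp (informProb G (update k c b))
        (fun b' => untouched π (update k (update k c b) b') y) ≤ η + if B b then 1 else 0 := by
      intro b
      split_ifs with hb
      · refine ((coinExp_mono (informProb_mem G _) fun b' => untouched_le_one y).trans
          (coinExp_const _ _).le).trans (by linarith)
      · rw [add_zero]
        have hb' : p₀ * U'.card / 4 < ((U'.filter fun v => b v = true).card : ℝ) := not_le.1 hb
        refine (hD.coinExp_untouched_le (R := U'.filter fun v => b v = true) ?_ y).trans ?_
        · intro w hw
          simp only [U', U, Finset.mem_filter] at hw
          exact hc.fresh_update hw.1.1.2 hw.2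
        · refine Real.exp_le_exp.2 (neg_le_neg ?_)
          have h1 : reachCount G π (U'.filter fun v => b v = true) y =
              (U'.filter fun v => b v = true).card := by
            unfold reachCount
            congr 1
            refine Finset.filter_true_of_mem fun w hw => ?_
            exact (Finset.mem_filter.1 (Finset.mem_filter.1 hw).1).2
          rw [h1]
          have h2 : p₀ * M ≤ p₀ * U'.card := by gcongr
          have h3 : p₀ * M / 4 ≤ ((U'.filter fun v => b v = true).card : ℝ) := by linarith
          gcongr
    refine (coinExp_mono hm hpt).trans ?_
    rw [coinExp_add, coinExp_const]
    have : coinExp (informProb G c) (fun b => if B b then (1 : ℝ) else 0) =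
      coinProb (informProb G c) B := rfl
    linarith

end ExpanderData

end Spreading

section Growth

variable {V W : Type*} [Fintype V] [Fintype W] {H : SimpleGraph W} {L d k : ℕ} {G : SimpleGraph V}
  {π : V → W} {C p₀ σ α a : ℝ} {c : Config V}

/-! ### The last rounds -/

/-- An upper bound for the probability that some clique fails to make progress in a given round. -/
def stallBound (V W : Type*) [Fintype V] [Fintype W] (p₀ : ℝ) (L : ℕ) : ℝ :=
  (Fintype.card V + Fintype.card W) * Real.exp (-(p₀ ^ 2 * L / 8))

/-- An upper bound for the expected fraction of cliques that are still untouched two rounds after a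
fraction `a` of all cliques was touched for the first time. -/
def missBound (C p₀ σ a : ℝ) (L d : ℕ) : ℝ :=
  4 * C ^ 2 / (a * (d * L : ℕ)) + 2 * Real.exp (-(σ * p₀ * a * d / 16))

lemma stallBound_nonneg (p₀ : ℝ) (L : ℕ) : 0 ≤ stallBound V W p₀ L := by
  unfold stallBound
  positivity

lemma missBound_nonneg (ha : 0 ≤ a) : 0 ≤ missBound C p₀ σ a L d := by
  unfold missBound
  positivity

namespace ExpanderData

lemma coinProb_not_progress_le (hD : ExpanderData H L d G π C p₀ σ) (hc : WellFormed c) :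
    coinProb (informProb G c) (fun b => ¬ Progress π (p₀ * L / 8) c (update k c b)) ≤
      stallBound V W p₀ L :=
  hD.isCliqueReplacement.coinProb_not_progress_le hD.p₀_pos hD.p₀_le hD.two_mul_p₀_le hc

lemma card_eq (hD : ExpanderData H L d G π C p₀ σ) :
    (Fintype.card V : ℝ) = L * Fintype.card W := by
  have h := hD.isCliqueReplacement.card_nodesOver Finset.univ
  have h2 : nodesOver π (Finset.univ : Finset W) = (Finset.univ : Finset V) := by
    simp [nodesOver]
  rw [h2, Finset.card_univ, Finset.card_univ] at h
  exact_mod_cast h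

/-- If sufficiently many cliques are touched, two rounds fill them and `k` more rounds make their
nodes orange. -/
lemma hitProb_ge_of_touched (hD : ExpanderData H L d G π C p₀ σ) (hk : 1 ≤ k)
    (hc : Healthy π (p₀ * L / 8) c) (ht : α * Fintype.card W ≤ (touchedSet π c).card) :
    1 - 2 * stallBound V W p₀ L ≤ hitProb G k (orangeFractionGE α) (k + 2) c := by
  have hε := stallBound_nonneg (V := V) (W := W) p₀ L
  have h := hitProb_succ_ge (G := G) (k := k) (E := orangeFractionGE α) (T := k + 1) (c := c) hε
    (fun b => ¬ Progress π (p₀ * L / 8) c (update k c b)) (fun b hb => ?_)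
  · linarith [hD.coinProb_not_progress_le (k := k) hc.1]
  have hb' : Progress π (p₀ * L / 8) c (update k c b) := not_not.1 hb
  set c₁ := update k c b
  have h := hitProb_succ_ge (G := G) (k := k) (E := orangeFractionGE α) (T := k) (c := c₁) le_rfl
    (fun b => ¬ Progress π (p₀ * L / 8) c₁ (update k c₁ b)) (fun b₁ hb₁ => ?_)
  · linarith [hD.coinProb_not_progress_le (k := k) (c := c₁) hc.1.update]
  have hb₁' : Progress π (p₀ * L / 8) c₁ (update k c₁ b₁) := not_not.1 hb₁
  rw [sub_zero]
  refine (hitProb_orange_eq_one G (nodesOver π (touchedSet π c)) ?_ k _ fun v hv => ?_).ge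
  · rw [hD.isCliqueReplacement.card_nodesOver, hD.card_eq]
    push_cast
    nlinarith [mul_le_mul_of_nonneg_left ht (Nat.cast_nonneg (α := ℝ) L)]
  · refine hc.1.update.update.orangeWithin hk ?_
    have hx : Touched π c (π v) := by simpa [nodesOver] using hv
    have h1 : p₀ * L / 8 ≤ (freshIn c₁ (superNode π (π v))).card ∨ FullClique π c₁ (π v) := by
      rcases hc.2 _ hx with h | h | h
      · exact (hb' _).2 h
      · exact Or.inr ((hb' _).1 h)
      · exact Or.inr h.update
    rcases h1 with h | h
    · exact (hb₁' _).1 h v rfl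
    · exact h.update v rfl

/-- The final phase: once a constant fraction of all cliques is touched in one round, almost all
cliques are touched two rounds later. -/
lemma hitProb_ge_of_fresh (hD : ExpanderData H L d G π C p₀ σ) (hk : 1 ≤ k) (hα : α < 1)
    (ha : 0 < a) (hc : Healthy π (p₀ * L / 8) c) {A : Finset W} (hA : ∀ x ∈ A, FreshClique π c x)
    (haA : a * Fintype.card W ≤ A.card) :
    1 - (4 * stallBound V W p₀ L + missBound C p₀ σ a L d / (1 - α)) ≤
      hitProb G k (orangeFractionGE α) (k + 4) c := by
  have := hD.nonempty
  have hN : (0 : ℝ) < Fintype.card W := by exact_mod_cast Fintype.card_pos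
  have hL : (0 : ℝ) < L := by exact_mod_cast hD.L_pos
  have h1α : 0 < 1 - α := by linarith
  set ε := stallBound V W p₀ L with hε'
  have hε : 0 ≤ ε := stallBound_nonneg p₀ L
  set u : ℝ := 1 / ((1 - α) * Fintype.card W) with hu
  have hu0 : 0 ≤ u := by positivity
  let X : Config V → ℝ := fun c => u * ∑ y, untouched π c y
  have hX : ∀ c, 0 ≤ X c := fun c =>
    mul_nonneg hu0 (Finset.sum_nonneg fun y _ => untouched_nonneg y)
  have h2 : ∀ c, Healthy π (p₀ * L / 8) c →
      1 - 2 * ε - X c ≤ hitProb G k (orangeFractionGE α) (k + 2) c := by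
    intro c hc
    by_cases ht : α * Fintype.card W ≤ (touchedSet π c).card
    · have := hD.hitProb_ge_of_touched hk hc ht
      linarith [hX c]
    · have hsum : ∑ y, untouched π c y = Fintype.card W - (touchedSet π c).card := by
        have h1 : ∀ y, untouched π c y = 1 - if Touched π c y then (1 : ℝ) else 0 := fun y => by
          unfold untouched
          split_ifs <;> norm_num
        rw [Finset.sum_congr rfl fun y _ => h1 y, Finset.sum_sub_distrib, Finset.sum_boole]
        simp [touchedSet]
      have h1 : 1 ≤ X c := by
        simp only [X, hsum, hu]
        rw [one_div, inv_mul_eq_div, one_le_div (by positivity)]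
        push Not at ht
        linarith
      linarith [hitProb_nonneg G k (orangeFractionGE α) (k + 2) c]
  have h3 : ∀ c, Healthy π (p₀ * L / 8) c →
      1 - 3 * ε - coinExp (informProb G c) (fun b => X (update k c b)) ≤
        hitProb G k (orangeFractionGE α) (k + 3) c := by
    intro c hc
    have h := coinExp_ge_of_off (informProb_mem G c)
      (f := fun b => hitProb G k (orangeFractionGE α) (k + 2) (update k c b))
      (g := fun b => 1 - 2 * ε - X (update k c b))
      (B := fun b => ¬ Progress π (p₀ * L / 8) c (update k c b))
      (fun b => hitProb_nonneg _ _ _ _ _) (fun b => by linarith [hX (update k c b)])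
      (fun b hb => h2 _ (hc.update (not_not.1 hb)))
    rw [coinExp_sub, coinExp_const] at h
    have h' := hD.coinProb_not_progress_le (k := k) hc.1
    refine le_trans ?_ h
    linarith
  have h4 : 1 - 4 * ε - coinExp (informProb G c) (fun b => coinExp (informProb G (update k c b))
      (fun b' => X (update k (update k c b) b'))) ≤
        hitProb G k (orangeFractionGE α) (k + 4) c := by
    have h := coinExp_ge_of_off (informProb_mem G c)
      (f := fun b => hitProb G k (orangeFractionGE α) (k + 3) (update k c b))
      (g := fun b => 1 - 3 * ε - coinExp (informProb G (update k c b))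
        (fun b' => X (update k (update k c b) b')))
      (B := fun b => ¬ Progress π (p₀ * L / 8) c (update k c b))
      (fun b => hitProb_nonneg _ _ _ _ _)
      (fun b => by
        have h := coinExp_nonneg (informProb_mem G (update k c b))
          (fun b' => hX (update k (update k c b) b'))
        linarith)
      (fun b hb => h3 _ (hc.update (not_not.1 hb)))
    rw [coinExp_sub, coinExp_const] at h
    have h' := hD.coinProb_not_progress_le (k := k) hc.1
    refine le_trans ?_ h
    linarith
  refine le_trans ?_ h4
  simp only [X]
  simp_rw [coinExp_mul_left, coinExp_sum]
  set S := Finset.univ.filter fun y => (nbrCount H A y : ℝ) < (d * L : ℕ) * a / 2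
  have hS : (S.card : ℝ) ≤ 4 * C ^ 2 / (a * (d * L : ℕ)) * Fintype.card W :=
    card_nbrCount_lt_le hD.smallVariance (Nat.mul_pos hD.d_pos hD.L_pos) ha haA
  set E : W → ℝ := fun y => coinExp (informProb G c) (fun b =>
    coinExp (informProb G (update k c b)) (fun b' => untouched π (update k (update k c b) b') y))
  have hE1 : ∀ y, E y ≤ 1 := fun y => by
    refine (coinExp_mono (informProb_mem G c) fun b => ?_).trans (coinExp_const _ 1).le
    exact (coinExp_mono (informProb_mem G _) fun b' => untouched_le_one y).trans
      (coinExp_const _ 1).le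
  have hEpt : ∀ y, E y ≤ (if y ∈ S then 1 else 0) +
      2 * Real.exp (-(σ * p₀ * a * d / 16)) := by
    intro y
    by_cases hy : y ∈ S
    · rw [if_pos hy]
      have := Real.exp_pos (-(σ * p₀ * a * d / 16))
      linarith [hE1 y]
    · rw [if_neg hy, zero_add]
      have hy' : ((d * L : ℕ) : ℝ) * a / 2 ≤ nbrCount H A y := by
        by_contra hlt
        exact hy (Finset.mem_filter.2 ⟨Finset.mem_univ _, not_le.1 hlt⟩)
      refine (hD.coinExp_coinExp_untouched_le (k := k) hc.1 hA
        (M := ((d * L : ℕ) : ℝ) * a / 4) (by positivity) (by linarith)).trans (le_of_eq ?_)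
      congr 3
      push_cast
      field_simp
      norm_num
  have hsumE : ∑ y, E y ≤ missBound C p₀ σ a L d * Fintype.card W := by
    refine (Finset.sum_le_sum fun y _ => hEpt y).trans ?_
    rw [Finset.sum_add_distrib, Finset.sum_const, Finset.card_univ, nsmul_eq_mul]
    simp only [Finset.sum_ite_mem, Finset.univ_inter, Finset.sum_const, nsmul_eq_mul, mul_one]
    unfold missBound
    linarith
  have hfin : u * ∑ y, E y ≤ missBound C p₀ σ a L d / (1 - α) := by
    calc _ ≤ u * (missBound C p₀ σ a L d * Fintype.card W) := by gcongr
      _ = _ := by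
        rw [hu]
        field_simp
  linarith

end ExpanderData

/-! ### The growth phase -/

/-- Many cliques, at least `m` or a fraction `a`, are fresh.  They are a constant fraction of the
touched ones. -/
def Seeded (π : V → W) (q a m : ℝ) (c : Config V) : Prop :=
  Healthy π q c ∧ ∃ A : Finset W, (∀ x ∈ A, FreshClique π c x) ∧
    ((touchedSet π c).card : ℝ) ≤ 4 * A.card ∧ (m ≤ A.card ∨ a * Fintype.card W ≤ A.card)

/-- At least `m` cliques contain a fraction `ρ` of fresh nodes on average.  The number of touched
cliques exceeds theirs by a factor of at most `4 * (1 + r)` and is at most `β * |W|`. -/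
def Transmitting (π : V → W) (q : ℝ) (L : ℕ) (ρ r β m : ℝ) (c : Config V) : Prop :=
  Healthy π q c ∧ ∃ A : Finset W, ρ * (L * A.card) ≤ (freshIn c (nodesOver π A)).card ∧
    ((touchedSet π c).card : ℝ) ≤ 4 * (1 + r) * A.card ∧
    ((touchedSet π c).card : ℝ) ≤ β * Fintype.card W ∧ m ≤ A.card

namespace ExpanderData

variable {r m ε : ℝ} {T : ℕ}

/-- A round in which the fresh nodes transmit multiplies the number of fresh cliques by `r`. -/
lemma hitProb_succ_ge_of_transmitting (hD : ExpanderData H L d G π C p₀ σ) (hr : 1 ≤ r)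
    (hrd : r ^ 2 = d) (hκr : 11 ≤ growthConst (p₀ / 8) σ * r) (hL : 128 * C ^ 2 ≤ (p₀ / 8) ^ 2 * L)
    (hε : 0 ≤ ε)
    (hT : ∀ c, Seeded π (p₀ * L / 8) (growthConst (p₀ / 8) σ / 16) (r * m) c →
      1 - ε ≤ hitProb G k (orangeFractionGE α) T c)
    (hc : Transmitting π (p₀ * L / 8) L (p₀ / 8) r (growthConst (p₀ / 8) σ / 2) m c) :
    1 - (ε + stallBound V W p₀ L + Real.exp (-(growthConst (p₀ / 8) σ *
      min (d * m) (Fintype.card W) / 4))) ≤ hitProb G k (orangeFractionGE α) (T + 1) c := by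
  obtain ⟨hh, A, hR, hI, hIN, hm⟩ := hc
  have hκ := hD.growthConst_pos
  have hκ' := hD.growthConst_le
  have hp := hD.p₀_pos
  set κ := growthConst (p₀ / 8) σ
  set N : ℝ := (Fintype.card W : ℝ) with hN
  have hN0 : 0 ≤ N := by positivity
  have hd : (d : ℝ) = r * r := by rw [← hrd]; ring
  have hA0 : (0 : ℝ) ≤ A.card := by positivity
  have hrA : 11 * (r * A.card) ≤ κ * (d * A.card) := by
    rw [hd]
    have : 11 * (r * A.card) ≤ κ * r * (r * A.card) := by gcongr
    linarith
  have hrA1 : (A.card : ℝ) ≤ r * A.card := le_mul_of_one_le_left hA0 hr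
  have key := hD.coinProb_card_newly_touched_le (k := k) (c := c) (A := A)
    (R := freshIn c (nodesOver π A)) (ρ := p₀ / 8) (μ := κ * min (d * A.card : ℝ) N) (by positivity)
    (fun w hw => (Finset.mem_filter.1 hw).2)
    (fun w hw => by simpa [nodesOver] using (Finset.mem_filter.1 hw).1) hR (by
      have : κ * N ≤ p₀ / 8 / 4 * N := by gcongr
      have : (0 : ℝ) ≤ p₀ / 8 * N := by positivity
      linarith) (by
      calc 16 * C ^ 2 * ((touchedSet π c).card : ℝ) ≤ 16 * C ^ 2 * (4 * (1 + r) * A.card) := by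
            gcongr
        _ ≤ 16 * C ^ 2 * (4 * (r + r) * A.card) := by gcongr
        _ = 128 * C ^ 2 * (r * A.card) := by ring
        _ ≤ (p₀ / 8) ^ 2 * L * (r * A.card) := by gcongr
        _ ≤ (p₀ / 8) ^ 2 * L * (r * (r * A.card)) := by gcongr
        _ = _ := by
          push_cast
          rw [hd]
          ring) le_rfl
  have h := hitProb_succ_ge (G := G) (k := k) (E := orangeFractionGE α) (T := T) (c := c) hε
    (fun b => ¬ Progress π (p₀ * L / 8) c (update k c b) ∨
      ((touchedSet π (update k c b) \ touchedSet π c).card : ℝ) ≤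
        κ * min (d * A.card : ℝ) N / 4) (fun b hb => ?_)
  · have h1 := coinProb_or_le (informProb_mem G c)
      (fun b => ¬ Progress π (p₀ * L / 8) c (update k c b))
      (fun b => ((touchedSet π (update k c b) \ touchedSet π c).card : ℝ) ≤
        κ * min (d * A.card : ℝ) N / 4)
    have h2 := hD.coinProb_not_progress_le (k := k) hh.1
    have h3 : Real.exp (-(κ * min (d * A.card : ℝ) N / 4)) ≤
        Real.exp (-(κ * min (d * m) N / 4)) := by gcongr
    linarith
  · push Not at hb
    obtain ⟨hb1, hb2⟩ := hb
    refine hT _ ⟨hh.update hb1, touchedSet π (update k c b) \ touchedSet π c, fun x hx => ?_, ?_⟩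
    · simp only [Finset.mem_sdiff, mem_touchedSet] at hx
      exact hh.1.freshClique_update hx.2 hx.1
    have h1 := card_touchedSet_update_le (π := π) (c := c) (k := k) b
    rcases le_total (d * A.card : ℝ) N with h2 | h2
    · rw [min_eq_left h2] at hb2
      have h3 : r * m ≤ r * A.card := by gcongr
      exact ⟨by linarith, Or.inl (by linarith)⟩
    · rw [min_eq_right h2] at hb2
      have : 0 ≤ κ * N := by positivity
      exact ⟨by linarith, Or.inr (by linarith)⟩

/-- Within two rounds, the number of fresh cliques grows by the factor `r`, or the final phase
begins.  If too many cliques are touched already one round later for the expansion argument, then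
these newly touched cliques are a sufficiently large set of fresh cliques. -/
lemma hitProb_add_two_ge_of_seeded (hD : ExpanderData H L d G π C p₀ σ) (hk : 1 ≤ k) (hα : α < 1)
    (hr : 1 ≤ r)
    (hrd : r ^ 2 = d) (hκr : 11 ≤ growthConst (p₀ / 8) σ * r) (hL : 128 * C ^ 2 ≤ (p₀ / 8) ^ 2 * L)
    (hm : 1 ≤ m) (hkT : k + 4 ≤ T)
    (hε : 4 * stallBound V W p₀ L +
      missBound C p₀ σ (growthConst (p₀ / 8) σ / 16) L d / (1 - α) ≤ ε)
    (hT : ∀ c, Seeded π (p₀ * L / 8) (growthConst (p₀ / 8) σ / 16) (r * m) c →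
      1 - ε ≤ hitProb G k (orangeFractionGE α) T c)
    (hc : Seeded π (p₀ * L / 8) (growthConst (p₀ / 8) σ / 16) m c) :
    1 - (ε + 2 * stallBound V W p₀ L + Real.exp (-(p₀ / 8 * L)) +
      Real.exp (-(growthConst (p₀ / 8) σ * min (d * m) (Fintype.card W) / 4))) ≤
        hitProb G k (orangeFractionGE α) (T + 2) c := by
  have hκ := hD.growthConst_pos
  have hκ' := hD.growthConst_le
  have hp := hD.p₀_pos
  have hp1 := hD.p₀_le
  have hs := stallBound_nonneg (V := V) (W := W) p₀ L
  have hmiss : 0 ≤ missBound C p₀ σ (growthConst (p₀ / 8) σ / 16) L d / (1 - α) :=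
    div_nonneg (missBound_nonneg (by positivity)) (by linarith)
  have hε0 : 0 ≤ ε := by linarith
  have htr : ∀ c, _ → _ := fun c =>
    hD.hitProb_succ_ge_of_transmitting (c := c) (α := α) hr hrd hκr hL hε0 hT
  obtain ⟨hh, A, hA, hI, hmA⟩ := hc
  have hmono : ∀ {T T' : ℕ} (_ : T ≤ T') (c : Config V),
      hitProb G k (orangeFractionGE α) T c ≤ hitProb G k (orangeFractionGE α) T' c :=
    fun h c => hitProb_mono (fun c hc b => orangeFractionGE_update hc) h c
  set κ := growthConst (p₀ / 8) σ
  set N : ℝ := (Fintype.card W : ℝ) with hN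
  set η₁ := Real.exp (-(p₀ / 8 * L))
  set η₂ := Real.exp (-(κ * min (d * m) N / 4))
  have hη₁ : 0 < η₁ := Real.exp_pos _
  have hη₂ : 0 < η₂ := Real.exp_pos _
  by_cases haA : κ / 16 * N ≤ A.card
  · have := hD.hitProb_ge_of_fresh hk hα (by positivity) hh hA haA
    have h2 := hmono (show k + 4 ≤ T + 2 by omega) c
    linarith
  have hmA' : m ≤ A.card := hmA.resolve_right haA
  push Not at haA
  have hAI : (A.card : ℝ) ≤ (touchedSet π c).card := by
    exact_mod_cast Finset.card_le_card fun x hx => mem_touchedSet.2 (hA x hx).1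
  have hL0 : (0 : ℝ) < L := by exact_mod_cast hD.L_pos
  by_cases hU : (L * A.card : ℝ) / 2 ≤ ((nodesOver π A).filter (Unc c)).card
  · have key := hD.coinProb_card_freshIn_le (k := k) hh.1 hA hU
    have h := hitProb_succ_ge (G := G) (k := k) (E := orangeFractionGE α) (T := T + 1) (c := c)
      (ε := ε + stallBound V W p₀ L + η₂) (by linarith)
      (fun b => ¬ Progress π (p₀ * L / 8) c (update k c b) ∨
        ((freshIn (update k c b) (nodesOver π A)).card : ℝ) ≤ p₀ / 8 * (L * A.card))
      (fun b hb => ?_)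
    · have h1 := coinProb_or_le (informProb_mem G c)
        (fun b => ¬ Progress π (p₀ * L / 8) c (update k c b))
        (fun b => ((freshIn (update k c b) (nodesOver π A)).card : ℝ) ≤ p₀ / 8 * (L * A.card))
      have h2 := hD.coinProb_not_progress_le (k := k) hh.1
      have h3 : Real.exp (-(p₀ / 8 * (L * A.card))) ≤ η₁ := by
        refine Real.exp_le_exp.2 (neg_le_neg ?_)
        have : (L : ℝ) ≤ L * A.card := le_mul_of_one_le_right hL0.le (hm.trans hmA')
        gcongr
      linarith
    · push Not at hb
      obtain ⟨hb1, hb2⟩ := hb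
      set c' := update k c b
      have hh' : Healthy π (p₀ * L / 8) c' := hh.update hb1
      have hfresh : ∀ x ∈ touchedSet π c' \ touchedSet π c, FreshClique π c' x := by
        intro x hx
        simp only [Finset.mem_sdiff, mem_touchedSet] at hx
        exact hh.1.freshClique_update hx.2 hx.1
      have h1 := card_touchedSet_update_le (π := π) (c := c) (k := k) b
      have hI0 : (0 : ℝ) ≤ (touchedSet π c).card := by positivity
      by_cases hnew : r * (touchedSet π c).card ≤ (touchedSet π c' \ touchedSet π c).card
      · have h2 : ((touchedSet π c).card : ℝ) ≤ r * (touchedSet π c).card :=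
          le_mul_of_one_le_left hI0 hr
        have h3 : r * m ≤ r * (touchedSet π c).card := by
          gcongr
          linarith
        have h4 := hT c' ⟨hh', _, hfresh, by linarith, Or.inl (by linarith)⟩
        have h5 := hmono (Nat.le_succ T) c'
        linarith
      · push Not at hnew
        by_cases hβ : ((touchedSet π c').card : ℝ) ≤ κ / 2 * N
        · have h2 : (1 + r) * ((touchedSet π c).card : ℝ) ≤ (1 + r) * (4 * A.card) := by
            gcongr
          have h3 := htr c' ⟨hh', A, hb2.le, by linarith, hβ, hmA'⟩
          linarith
        · push Not at hβ
          have h4 := hT c' ⟨hh', _, hfresh, by linarith, Or.inr (by linarith)⟩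
          have h5 := hmono (Nat.le_succ T) c'
          linarith
  · push Not at hU
    have hcard : (((nodesOver π A).filter (Unc c)).card : ℝ) +
        (freshIn c (nodesOver π A)).card = L * A.card := by
      have h1 := Finset.card_filter_add_card_filter_not (s := nodesOver π A) (Unc c)
      rw [hD.isCliqueReplacement.card_nodesOver] at h1
      have h2 : (nodesOver π A).filter (fun v => ¬ Unc c v) = freshIn c (nodesOver π A) := by
        refine Finset.filter_congr fun v hv => ⟨fun h => ?_, fun h => h.not_unc⟩
        exact ((hA (π v) (by simpa [nodesOver] using hv)).2 v rfl).resolve_left h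
      rw [h2] at h1
      exact_mod_cast h1
    have hLA : 0 ≤ (L * A.card : ℝ) := by positivity
    have h2 : p₀ * (L * A.card : ℝ) ≤ 1 * (L * A.card) := by gcongr
    have h3 : (A.card : ℝ) ≤ r * A.card := le_mul_of_one_le_left (by positivity) hr
    have h4 := htr c ⟨hh, A, by linarith, by linarith, by linarith, hmA'⟩
    have h5 := hmono (Nat.le_succ (T + 1)) c
    have h6 : hitProb G k (orangeFractionGE α) (T + 1).succ c =
      hitProb G k (orangeFractionGE α) (T + 2) c := rfl
    linarith

/-- The growth phase, by backward induction on the number `i` of remaining growth steps.  The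
failure probabilities of the steps form a geometric series, up to terms that are small in `L`. -/
lemma hitProb_ge_of_seeded (hD : ExpanderData H L d G π C p₀ σ) (hk : 1 ≤ k) (hα : α < 1)
    (hr : 2 ≤ r)
    (hrd : r ^ 2 = d) (hκr : 11 ≤ growthConst (p₀ / 8) σ * r) (hL : 128 * C ^ 2 ≤ (p₀ / 8) ^ 2 * L)
    (i j : ℕ) (hij : (Fintype.card W : ℝ) < r ^ (i + j))
    (hc : Seeded π (p₀ * L / 8) (growthConst (p₀ / 8) σ / 16) (r ^ j) c) :
    1 - (4 * stallBound V W p₀ L +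
        missBound C p₀ σ (growthConst (p₀ / 8) σ / 16) L d / (1 - α) +
      i * (2 * stallBound V W p₀ L + Real.exp (-(p₀ / 8 * L)) +
        Real.exp (-(growthConst (p₀ / 8) σ * Fintype.card W / 4))) +
      8 / (growthConst (p₀ / 8) σ * d) * (1 / 2) ^ j) ≤
        hitProb G k (orangeFractionGE α) (k + 4 + 2 * i) c := by
  have hκ := hD.growthConst_pos
  have hd0 : (0 : ℝ) < d := by exact_mod_cast hD.d_pos
  have hs := stallBound_nonneg (V := V) (W := W) p₀ L
  have hmiss : 0 ≤ missBound C p₀ σ (growthConst (p₀ / 8) σ / 16) L d / (1 - α) :=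
    div_nonneg (missBound_nonneg (by positivity)) (by linarith)
  induction i generalizing j c with
  | zero =>
    obtain ⟨hh, A, hA, -, hmA⟩ := hc
    have hAW : (A.card : ℝ) ≤ Fintype.card W := by exact_mod_cast Finset.card_le_univ A
    rw [zero_add] at hij
    have haA := hmA.resolve_left (by linarith)
    have h1 := hD.hitProb_ge_of_fresh hk hα (by positivity) hh hA haA
    have : 0 ≤ 8 / (growthConst (p₀ / 8) σ * d) * (1 / 2 : ℝ) ^ j := by positivity
    simp only [Nat.cast_zero, zero_mul, add_zero, mul_zero]
    linarith
  | succ i ih =>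
    have h1 := hD.hitProb_add_two_ge_of_seeded (α := α) (T := k + 4 + 2 * i) hk hα (by linarith)
      hrd hκr hL (m := r ^ j) (one_le_pow₀ (by linarith)) (by omega)
      (ε := 4 * stallBound V W p₀ L +
          missBound C p₀ σ (growthConst (p₀ / 8) σ / 16) L d / (1 - α) +
        i * (2 * stallBound V W p₀ L + Real.exp (-(p₀ / 8 * L)) +
          Real.exp (-(growthConst (p₀ / 8) σ * Fintype.card W / 4))) +
        8 / (growthConst (p₀ / 8) σ * d) * (1 / 2) ^ (j + 1))
      (by
        have h1 : 0 ≤ 8 / (growthConst (p₀ / 8) σ * d) * (1 / 2 : ℝ) ^ (j + 1) := by positivity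
        have h2 : 0 ≤ i * (2 * stallBound V W p₀ L + Real.exp (-(p₀ / 8 * L)) +
          Real.exp (-(growthConst (p₀ / 8) σ * Fintype.card W / 4))) := by positivity
        linarith)
      (fun c hc => ih (j + 1) (by rwa [add_right_comm] at hij) (by rwa [pow_succ'])) hc
    refine le_trans ?_ h1
    set κ := growthConst (p₀ / 8) σ
    set N : ℝ := (Fintype.card W : ℝ)
    have hpow : (2 : ℝ) ^ j ≤ r ^ j := by gcongr
    have h2 : Real.exp (-(κ * min (d * r ^ j) N / 4)) ≤
        4 / (κ * d) * (1 / 2) ^ j + Real.exp (-(κ * N / 4)) := by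
      rcases le_total (d * r ^ j) N with h | h
      · rw [min_eq_left h]
        have h3 : Real.exp (-(κ * (d * r ^ j) / 4)) ≤ 1 / (κ * (d * r ^ j) / 4) := by
          have hx : 0 < κ * (d * r ^ j) / 4 := by positivity
          rw [Real.exp_neg, ← one_div]
          exact one_div_le_one_div_of_le hx
            (by linarith [Real.add_one_le_exp (κ * (d * r ^ j) / 4)])
        have h4 : 1 / (κ * (d * r ^ j) / 4) ≤ 1 / (κ * (d * 2 ^ j) / 4) := by gcongr
        have h5 : 1 / (κ * (d * 2 ^ j) / 4) = 4 / (κ * d) * (1 / 2) ^ j := by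
          rw [one_div_pow]
          field_simp
        linarith [Real.exp_pos (-(κ * N / 4))]
      · rw [min_eq_right h]
        have : 0 ≤ 4 / (κ * d) * (1 / 2 : ℝ) ^ j := by positivity
        linarith
    have h3 : 8 / (κ * d) * (1 / 2 : ℝ) ^ j =
        8 / (κ * d) * (1 / 2) ^ (j + 1) + 4 / (κ * d) * (1 / 2) ^ j := by
      rw [pow_succ]
      ring
    rw [h3]
    push_cast
    linarith

lemma seeded_initial (π : V → W) (q a : ℝ) (v₀ : V) : Seeded π q a 1 (initial v₀) := by
  have ht : ∀ x, Touched π (initial v₀) x → x = π v₀ := by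
    rintro x ⟨v, rfl, hv⟩
    by_contra hne
    exact hv (unc_initial fun h => hne (h ▸ rfl))
  have hf : FreshClique π (initial v₀) (π v₀) := by
    refine ⟨⟨v₀, rfl, (fresh_initial v₀).not_unc⟩, fun v _ => ?_⟩
    by_cases h : v = v₀
    · exact Or.inr (h ▸ fresh_initial v₀)
    · exact Or.inl (unc_initial h)
  refine ⟨⟨wellFormed_initial v₀, fun x hx => Or.inl (ht x hx ▸ hf)⟩, {π v₀}, ?_, ?_, ?_⟩
  · intro x hx
    rw [Finset.mem_singleton.1 hx]
    exact hf
  · have : (touchedSet π (initial v₀)).card ≤ ({π v₀} : Finset W).card :=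
      Finset.card_le_card fun x hx => by simpa using ht x (mem_touchedSet.1 hx)
    have h' : ((touchedSet π (initial v₀)).card : ℝ) ≤ ({π v₀} : Finset W).card := by
      exact_mod_cast this
    simp only [Finset.card_singleton, Nat.cast_one] at h' ⊢
    linarith
  · simp

end ExpanderData

end Growth

/-! ### Confinement to the first clique -/

section Confinement

variable {V W : Type*} {H : SimpleGraph W} {L d k : ℕ} {G : SimpleGraph V}
  {π : V → W} {c : Config V} {α : ℝ}

/-- All colored nodes belong to the clique of `x`. -/
def Confined (π : V → W) (x : W) (c : Config V) : Prop := ∀ v, ¬ Unc c v → π v = x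

/-- The strength with which a node transmits along an edge in the next round, up to the similarity
of its end nodes. -/
def strength (c : Config V) (v : V) : ℝ :=
  match c v with
  | (Color.uncolored, _) => 0
  | (Color.red, j) => 1 / 2 ^ j
  | (Color.orange, _) => 0

/-- An upper bound for the total strength with which a node transmits along an edge from the next
round on. -/
def remaining (c : Config V) (v : V) : ℝ :=
  match c v with
  | (Color.uncolored, _) => 1
  | (Color.red, j) => 2 / 2 ^ j
  | (Color.orange, _) => 0

lemma remaining_nonneg (c : Config V) (v : V) : 0 ≤ remaining c v := by
  unfold remaining
  rcases c v with ⟨_ | _ | _, j⟩ <;> positivity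

lemma strength_nonneg (c : Config V) (v : V) : 0 ≤ strength c v := by
  unfold strength
  rcases c v with ⟨_ | _ | _, j⟩ <;> simp

/-- The strength that a node uses in one round is taken from its remaining strength. -/
lemma strength_add_remaining_update_le (hc : WellFormed c) (b : V → Bool) (v : V) :
    strength c v + remaining (update k c b) v ≤ remaining c v := by
  have h0 := (hc v).1
  unfold strength remaining update
  rcases hv : c v with ⟨_ | _ | _, j⟩
  · have hj : j = 0 := by simpa [hv] using h0
    subst hj
    by_cases hb : b v <;> simp [hb]
  · have h : (1 : ℝ) / 2 ^ j + 2 / 2 ^ (j + 1) = 2 / 2 ^ j := by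
      rw [pow_succ]
      field_simp
      norm_num
    by_cases hj : j < k
    · simpa [hj] using h.le
    · have : (0 : ℝ) < 2 / 2 ^ j := by positivity
      simp only [hj, if_false, add_zero]
      gcongr
      norm_num
  · simp

lemma exp_neg_two_mul_le {x : ℝ} (h0 : 0 ≤ x) (h1 : x ≤ 1 / 2) : Real.exp (-(2 * x)) ≤ 1 - x := by
  have h2 : Real.exp (-(2 * x)) ≤ 1 / (1 + 2 * x) := by
    rw [Real.exp_neg, ← one_div]
    exact one_div_le_one_div_of_le (by linarith) (by linarith [Real.add_one_le_exp (2 * x)])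
  refine h2.trans ?_
  rw [div_le_iff₀ (by linarith)]
  nlinarith

namespace IsCliqueReplacement

variable [Fintype V]

lemma exp_le_stayProb (hG : IsCliqueReplacement H L d G π) (hc : WellFormed c) {x : W}
    (hx : Confined π x c) {v : V} (hv : π v ≠ x) :
    Real.exp (-(2 * ((d + 1) / L) * ∑ w ∈ Finset.univ.filter (G.Adj v), strength c w)) ≤
      stayProb G c v := by
  unfold stayProb
  rw [Finset.mul_sum, ← Finset.sum_neg_distrib, Real.exp_sum, ← Finset.filter_filter,
    Finset.prod_filter (fun w => (c w).1 = Color.red)]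
  refine Finset.prod_le_prod (fun w _ => (Real.exp_pos _).le) fun w hw => ?_
  have hadj : G.Adj v w := (Finset.mem_filter.1 hw).2
  split_ifs with hr
  · have hw1 := (hc w).2 hr
    have hwx : π w = x := hx w (by unfold Unc; simp [hr])
    have hS := hG.similarity_le_of_ne hadj (by rwa [hwx])
    have hst : strength c w = 1 / 2 ^ (c w).2 := by
      unfold strength
      rcases h : c w with ⟨_ | _ | _, j⟩ <;> simp_all
    have h2 : (2 : ℝ) ≤ 2 ^ (c w).2 := by
      calc (2 : ℝ) = 2 ^ 1 := by norm_num
        _ ≤ _ := pow_le_pow_right₀ (by norm_num) hw1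
    refine le_trans ?_ (exp_neg_two_mul_le
      (div_nonneg (similarity_nonneg G v w) (by positivity)) ?_)
    · rw [hst]
      refine Real.exp_le_exp.2 (neg_le_neg ?_)
      rw [mul_assoc, mul_one_div]
      gcongr
    · have := similarity_le_one G hadj
      rw [div_le_iff₀ (by positivity)]
      linarith
  · refine Real.exp_le_one_iff.2 (neg_nonpos.2 ?_)
    exact mul_nonneg (by positivity) (strength_nonneg c w)

/-- The clique that contains all colored nodes does not transmit to other cliques in one round, with
a probability bounded below in terms of the strengths of its nodes. -/
lemma exp_le_prod_stayProb (hG : IsCliqueReplacement H L d G π) (hc : WellFormed c) {x : W}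
    (hx : Confined π x c) :
    Real.exp (-(2 * ((d + 1) / L) * d * ∑ w ∈ superNode π x, strength c w)) ≤
      ∏ v ∈ Finset.univ.filter (fun v => π v ≠ x), stayProb G c v := by
  refine le_trans ?_ (Finset.prod_le_prod (fun v _ => (Real.exp_pos _).le) fun v hv =>
    hG.exp_le_stayProb hc hx (Finset.mem_filter.1 hv).2)
  rw [← Real.exp_sum, Finset.sum_neg_distrib, ← Finset.mul_sum]
  refine Real.exp_le_exp.2 (neg_le_neg ?_)
  rw [mul_assoc (2 * _) (d : ℝ)]
  refine mul_le_mul_of_nonneg_left ?_ (by positivity)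
  simp_rw [Finset.sum_filter (G.Adj _)]
  rw [Finset.sum_comm, Finset.mul_sum]
  have hout : ∀ w, w ∉ superNode π x → strength c w = 0 := by
    intro w hw
    by_contra hne
    refine hw (mem_superNode.2 (hx w fun hu => hne ?_))
    unfold Unc at hu
    unfold strength
    rcases h : c w with ⟨_ | _ | _, j⟩ <;> simp_all
  rw [← Finset.sum_subset (Finset.subset_univ (superNode π x)) (fun w _ hw => by simp [hout w hw])]
  refine Finset.sum_le_sum fun w hw => ?_
  rw [← Finset.sum_filter, Finset.sum_const, nsmul_eq_mul]
  refine mul_le_mul_of_nonneg_right ?_ (strength_nonneg c w)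
  norm_cast
  rw [← hG.evenly w, ← Set.ncard_coe_finset]
  refine Set.ncard_le_ncard (fun v hv => ?_) (Set.toFinite _)
  simp only [Finset.coe_filter, Finset.mem_filter, Finset.mem_univ, true_and,
    Set.mem_ofPred_eq] at hv
  rw [mem_superNode.1 hw]
  exact ⟨hv.2.symm, hv.1⟩

/-- The process stays in the first clique with a probability that is bounded below in terms of the
remaining strengths of the nodes of this clique. -/
lemma exp_le_hitProb (hG : IsCliqueReplacement H L d G π) (hα : (L : ℝ) < α * Fintype.card V)
    {x : W} (t : ℕ) (hc : WellFormed c) (hx : Confined π x c) :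
    Real.exp (-(2 * ((d + 1) / L) * d * ∑ w ∈ superNode π x, remaining c w)) ≤
      hitProb G k (orangeFractionGE α)ᶜ t c := by
  have hnn : (0 : ℝ) ≤ 2 * ((d + 1) / L) * d := by positivity
  induction t generalizing c with
  | zero =>
    have h1 : c ∈ (orangeFractionGE (V := V) α)ᶜ := by
      intro h
      have h2 : {v | (c v).1 = Color.orange}.ncard ≤ L := by
        rw [← hG.card_superNode x]
        refine Set.ncard_le_ncard (fun v hv => hx v fun hu => ?_) (Set.toFinite _)
        unfold Unc at hu
        rw [Set.mem_ofPred_eq, hu] at hv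
        cases hv
      have h3 : ({v | (c v).1 = Color.orange}.ncard : ℝ) ≤ L := by exact_mod_cast h2
      have h4 : α * (Fintype.card V : ℝ) ≤ ({v | (c v).1 = Color.orange}.ncard : ℝ) := h
      linarith
    simp only [hitProb, h1, if_true]
    refine Real.exp_le_one_iff.2 (neg_nonpos.2 (mul_nonneg hnn ?_))
    exact Finset.sum_nonneg fun w _ => remaining_nonneg c w
  | succ t ih =>
    set U := Finset.univ.filter fun v => π v ≠ x
    set K := Real.exp (-(2 * ((d + 1) / L) * d *
      ∑ w ∈ superNode π x, (remaining c w - strength c w))) with hK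
    have h1 : coinExp (informProb G c) (fun b => K * if ∀ v ∈ U, b v = false then 1 else 0) ≤
        hitProb G k (orangeFractionGE α)ᶜ (t + 1) c := by
      refine coinExp_mono (informProb_mem G c) fun b => ?_
      split_ifs with hb
      · rw [mul_one]
        have hx' : Confined π x (update k c b) := by
          intro v hv
          by_contra hne
          refine hv (unc_update_iff.2 ⟨?_, hb v (by simp [U, hne])⟩)
          by_contra hu
          exact hne (hx v hu)
        refine le_trans (Real.exp_le_exp.2 (neg_le_neg ?_)) (ih hc.update hx')
        refine mul_le_mul_of_nonneg_left (Finset.sum_le_sum fun w _ => ?_) hnn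
        linarith [strength_add_remaining_update_le (k := k) hc b w]
      · rw [mul_zero]
        exact hitProb_nonneg _ _ _ _ _
    refine le_trans ?_ h1
    rw [coinExp_mul_left]
    have h2 : coinExp (informProb G c) (fun b => if ∀ v ∈ U, b v = false then (1 : ℝ) else 0) =
        ∏ v ∈ U, stayProb G c v := by
      refine Eq.trans ?_ ((coinProb_forall_false (informProb G c) U).trans
        (by simp [informProb]))
      unfold coinProb
      congr!
    rw [h2]
    calc _ = K * Real.exp (-(2 * ((d + 1) / L) * d * ∑ w ∈ superNode π x, strength c w)) := by
          rw [hK, ← Real.exp_add, Finset.sum_sub_distrib]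
          ring_nf
      _ ≤ _ := mul_le_mul_of_nonneg_left (hG.exp_le_prod_stayProb hc hx) (Real.exp_pos _).le

lemma exp_le_prob_law (hG : IsCliqueReplacement H L d G π) (hα : (L : ℝ) < α * Fintype.card V)
    (v₀ : V) (t : ℕ) :
    Real.exp (-(2 * (d + 1) * d)) ≤ prob (law G k v₀ t) (orangeFractionGE α)ᶜ := by
  rw [prob_law_eq]
  refine le_trans (le_of_eq ?_) (hG.exp_le_hitProb hα (x := π v₀) t (wellFormed_initial v₀)
    fun v hv => ?_)
  · have h1 : ∀ w ∈ superNode π (π v₀), remaining (initial v₀) w = 1 := by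
      intro w _
      by_cases h : w = v₀ <;> simp [remaining, initial, h]
    have hL : (L : ℝ) ≠ 0 := by exact_mod_cast (hG.L_pos v₀).ne'
    rw [Finset.sum_congr rfl h1, Finset.sum_const, hG.card_superNode']
    congr 2
    simp only [nsmul_eq_mul, mul_one]
    field_simp
  · by_contra hne
    exact hv (unc_initial fun h => hne (h ▸ rfl))

end IsCliqueReplacement

end Confinement

/-! ### Asymptotics -/

section Asymptotics

open Filter

lemma tendsto_log_natCast : Tendsto (fun n : ℕ => Real.log n) atTop atTop :=
  Real.tendsto_log_atTop.comp tendsto_natCast_atTop_atTop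

lemma tendsto_log_sq_natCast : Tendsto (fun n : ℕ => Real.log n ^ 2) atTop atTop :=
  (tendsto_pow_atTop two_ne_zero).comp tendsto_log_natCast

/-- Powers of logarithms are smaller than the identity. -/
lemma eventually_mul_log_pow_le (B : ℝ) (m : ℕ) : ∀ᶠ n : ℕ in atTop, B * Real.log n ^ m ≤ n := by
  have h := ((Real.isLittleO_pow_log_id_atTop (n := m)).const_mul_left B).comp_tendsto
    tendsto_natCast_atTop_atTop
  filter_upwards [h.bound one_pos] with n hn
  simp only [Function.comp_apply, one_mul, id, Real.norm_natCast] at hn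
  exact (le_abs_self _).trans hn

/-- The two roundings of `log² n`. -/
lemma size_bounds {n L : ℕ} (h : L = ⌊Real.log n ^ 2⌋₊ ∨ L = ⌈Real.log n ^ 2⌉₊) :
    Real.log n ^ 2 - 1 ≤ L ∧ (L : ℝ) ≤ Real.log n ^ 2 + 1 := by
  have h0 : 0 ≤ Real.log n ^ 2 := sq_nonneg _
  rcases h with rfl | rfl
  · exact ⟨by linarith [Nat.lt_floor_add_one (Real.log n ^ 2)],
      by linarith [Nat.floor_le h0]⟩
  · exact ⟨by linarith [Nat.le_ceil (Real.log n ^ 2)],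
      by linarith [Nat.ceil_lt_add_one h0]⟩

lemma expanderData {V W : Type*} [Fintype V] [Fintype W] [Nonempty W] {H : SimpleGraph W}
    {L d : ℕ} {G : SimpleGraph V} {π : V → W} {C B : ℝ} (hG : IsCliqueReplacement H L d G π)
    (hH : H.IsRegularOfDegree (d * L)) (hl : secondEigenvalue H ≤ C * √((d * L : ℕ) : ℝ))
    (hB : 0 < B) (hd : 1 ≤ d) (hL : 1 ≤ L) (hdL : (d : ℝ) ≤ B * L) (hCL : C ^ 2 < L) :
    ExpanderData H L d G π C (1 / (2 * (1 + 2 * B))) (1 / (2 * (1 + B))) where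
  nonempty := inferInstance
  isCliqueReplacement := hG
  isRegularOfDegree := hH
  smallVariance := by
    refine smallVariance hH hl ?_
    have hD : (L : ℝ) ≤ (d * L : ℕ) := by exact_mod_cast Nat.le_mul_of_pos_left L hd
    set D : ℝ := ((d * L : ℕ) : ℝ)
    have hD0 : 0 < D := lt_of_lt_of_le (by exact_mod_cast hL) hD
    have h1 : C < √D := Real.lt_sqrt_of_sq_lt (hCL.trans_le hD)
    calc C * √D < √D * √D := mul_lt_mul_of_pos_right h1 (Real.sqrt_pos.2 hD0)
      _ = D := Real.mul_self_sqrt hD0.le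
  L_pos := hL
  d_pos := hd
  p₀_pos := by positivity
  p₀_le := by
    rw [div_le_one (by positivity)]
    linarith
  two_mul_p₀_le := by
    have hL' : (0 : ℝ) < L := by exact_mod_cast hL
    have h1 : 2 * (1 / (2 * (1 + 2 * B))) = 1 / (1 + 2 * B) := by field_simp
    rw [h1, div_le_div_iff₀ (by positivity) (by positivity)]
    linarith
  σ_pos := by positivity
  two_mul_σ_le := by
    have hL' : (0 : ℝ) < L := by exact_mod_cast hL
    have h1 : 2 * (1 / (2 * (1 + B)) / L) = 1 / ((1 + B) * L) := by field_simp
    rw [h1]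
    refine one_div_le_one_div_of_le (by positivity) ?_
    linarith
  σ_mul_le := by
    have h1 : 1 / (2 * (1 + B)) ≤ 1 := by
      rw [div_le_one (by positivity)]
      linarith
    calc _ ≤ 1 * C ^ 2 := by gcongr
      _ ≤ L := by linarith

/-- The bound for the failure probability in terms of the degree and the size of the graph.  The
constants `κ` and `p` stand for the growth constant and the probability of being informed. -/
lemma failure_bound {C κ p σ α : ℝ} (hκ : 0 < κ) (hκp : κ ≤ p) (hp : 0 < p) (hp1 : p ≤ 1)
    (hσ : 0 < σ)
    (hα : α < 1) : ∃ M c : ℝ, 0 < M ∧ 0 < c ∧ ∀ (V W : Type) [Fintype V] [Fintype W] (L d i : ℕ),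
      1 ≤ L → 1 ≤ d → Fintype.card V = Fintype.card W * L → L ≤ Fintype.card W →
      i ≤ 2 * Fintype.card V →
      4 * stallBound V W p L + missBound C p σ (κ / 16) L d / (1 - α) +
        i * (2 * stallBound V W p L + Real.exp (-(p / 8 * L)) +
          Real.exp (-(κ * Fintype.card W / 4))) + 8 / (κ * d) ≤
      M / d + 24 * (Fintype.card V : ℝ) ^ 2 * Real.exp (-(c * L)) := by
  have h1α : 0 < 1 - α := by linarith
  refine ⟨(4 * C ^ 2 / (κ / 16) + 2 * (16 / (σ * p * (κ / 16)))) / (1 - α) + 8 / κ,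
    min (p ^ 2 / 8) (κ / 4), by positivity, by positivity, ?_⟩
  intro V W _ _ L d i hL hd hV hLW hi
  have hL' : (1 : ℝ) ≤ L := by exact_mod_cast hL
  have hd' : (1 : ℝ) ≤ d := by exact_mod_cast hd
  have hLW' : (L : ℝ) ≤ Fintype.card W := by exact_mod_cast hLW
  have hi' : (i : ℝ) ≤ 2 * Fintype.card V := by exact_mod_cast hi
  have hWV : (Fintype.card W : ℝ) ≤ Fintype.card V := by
    rw [hV]
    exact_mod_cast Nat.le_mul_of_pos_right _ hL
  set n : ℝ := (Fintype.card V : ℝ)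
  have hn1 : 1 ≤ n := hL'.trans (hLW'.trans hWV)
  set c := min (p ^ 2 / 8) (κ / 4) with hc
  set e := Real.exp (-(c * L)) with he
  have he0 : 0 < e := Real.exp_pos _
  have hc1 : c ≤ p ^ 2 / 8 := min_le_left _ _
  have hc2 : c ≤ κ / 4 := min_le_right _ _
  have hpp : p ^ 2 ≤ p := by nlinarith
  have h1 : Real.exp (-(p ^ 2 * L / 8)) ≤ e := by
    refine Real.exp_le_exp.2 (neg_le_neg ?_)
    have : c * L ≤ p ^ 2 / 8 * L := by gcongr
    linarith
  have h2 : Real.exp (-(p / 8 * L)) ≤ e := by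
    refine Real.exp_le_exp.2 (neg_le_neg ?_)
    have : c * L ≤ p / 8 * L := by gcongr; linarith
    linarith
  have h3 : Real.exp (-(κ * Fintype.card W / 4)) ≤ e := by
    refine Real.exp_le_exp.2 (neg_le_neg ?_)
    have h4 : c * L ≤ κ / 4 * L := by gcongr
    have h5 : κ / 4 * L ≤ κ / 4 * Fintype.card W := by gcongr
    linarith
  have hstall : stallBound V W p L ≤ 2 * n * e := by
    unfold stallBound
    refine mul_le_mul (by linarith) h1 (Real.exp_pos _).le (by positivity)
  have hmiss : missBound C p σ (κ / 16) L d ≤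
      (4 * C ^ 2 / (κ / 16) + 2 * (16 / (σ * p * (κ / 16)))) / d := by
    unfold missBound
    rw [add_div]
    refine add_le_add ?_ ?_
    · rw [div_div]
      gcongr
      exact Nat.le_mul_of_pos_right _ hL
    · have hx : 0 < σ * p * (κ / 16) * d / 16 := by positivity
      have h4 : Real.exp (-(σ * p * (κ / 16) * d / 16)) ≤ 1 / (σ * p * (κ / 16) * d / 16) := by
        rw [Real.exp_neg, ← one_div]
        exact one_div_le_one_div_of_le hx
          (by linarith [Real.add_one_le_exp (σ * p * (κ / 16) * d / 16)])
      have h5 : 2 * (1 / (σ * p * (κ / 16) * d / 16)) = 2 * (16 / (σ * p * (κ / 16))) / d := by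
        field_simp
      linarith
  have hmiss' : missBound C p σ (κ / 16) L d / (1 - α) + 8 / (κ * d) ≤
      ((4 * C ^ 2 / (κ / 16) + 2 * (16 / (σ * p * (κ / 16)))) / (1 - α) + 8 / κ) / d := by
    rw [add_div, div_right_comm _ (1 - α), div_div 8 κ]
    gcongr
  have hmul : i * (2 * stallBound V W p L + Real.exp (-(p / 8 * L)) +
      Real.exp (-(κ * Fintype.card W / 4))) ≤ 2 * n * (2 * (2 * n * e) + e + e) := by
    have := stallBound_nonneg (V := V) (W := W) p L
    gcongr
  have h6 : n * e ≤ n ^ 2 * e := by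
    have : n ≤ n ^ 2 := by nlinarith
    gcongr
  have h7 : 2 * n * (2 * (2 * n * e) + e + e) = 8 * (n ^ 2 * e) + 4 * (n * e) := by ring
  have h8 : 24 * n ^ 2 * e = 24 * (n ^ 2 * e) := by ring
  have h9 : 0 ≤ n ^ 2 * e := by positivity
  rw [h8]
  linarith

/-- As `L` is of order `log² n`, the factor `exp (-c * L)` beats every power of `n`. -/
lemma eventually_sq_mul_exp_le {c ε : ℝ} (hc : 0 < c) (hε : 0 < ε) :
    ∀ᶠ n : ℕ in atTop, ∀ L : ℕ, Real.log n ^ 2 - 1 ≤ L →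
      24 * (n : ℝ) ^ 2 * Real.exp (-(c * L)) ≤ ε := by
  filter_upwards [tendsto_log_natCast.eventually_ge_atTop (4 / c),
    tendsto_log_natCast.eventually_ge_atTop (c + Real.log (24 / ε)),
    tendsto_log_natCast.eventually_ge_atTop 1, eventually_ge_atTop 1] with n h1 h2 h3 h4 L hL
  have hn : (0 : ℝ) < n := by exact_mod_cast h4
  set x := Real.log n
  have hx : Real.exp x = n := Real.exp_log hn
  have h5 : (24 : ℝ) = ε * Real.exp (Real.log (24 / ε)) := by
    rw [Real.exp_log (by positivity)]
    field_simp
  rw [h5, ← hx, ← Real.exp_nat_mul, mul_assoc, mul_assoc, ← Real.exp_add, ← Real.exp_add]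
  refine mul_le_of_le_one_right hε.le (Real.exp_le_one_iff.2 ?_)
  rw [div_le_iff₀ hc] at h1
  have h6 : c * (x ^ 2 - 1) ≤ c * L := by gcongr
  have h7 : 4 * x ≤ x * c * x := by gcongr
  push_cast
  nlinarith

/-- Part (a): if the degree tends to infinity, the rumor spreads. -/
lemma eventually_le_prob_law {C : ℝ} {k : ℕ} (hk : 1 ≤ k) {α : ℝ} (hα : α < 1) {d : ℕ → ℕ}
    (hd : Tendsto d atTop atTop)
    (hdO : (fun n => (d n : ℝ)) =O[atTop] fun n : ℕ => Real.log n ^ 2) {ε : ℝ} (hε : 0 < ε) :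
    ∀ᶠ n : ℕ in atTop, ∀ G : SimpleGraph (Fin n), IsModerateExpander C n (d n) G →
      ∀ v₀ : Fin n, 1 - ε ≤ prob (law G k v₀ ⌊5 * Real.logb (d n) n⌋₊) (orangeFractionGE α) := by
  obtain ⟨B, hB, hdB⟩ := hdO.exists_pos
  set p : ℝ := 1 / (2 * (1 + 2 * (2 * B))) with hp
  set σ : ℝ := 1 / (2 * (1 + 2 * B)) with hσ
  have hp0 : 0 < p := by positivity
  have hp1 : p ≤ 1 := by
    rw [hp, div_le_one (by positivity)]
    linarith
  have hσ0 : 0 < σ := by positivity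
  set κ : ℝ := growthConst (p / 8) σ with hκ
  have hκ0 : 0 < κ := by
    rw [hκ]
    unfold growthConst
    positivity
  have hκp : κ ≤ p := by
    rw [hκ]
    unfold growthConst
    rw [div_le_iff₀ (by positivity)]
    have h1 : p * (p * σ) ≤ 1 * (p * σ) := by gcongr
    have h2 : 0 < p * σ := by positivity
    nlinarith
  obtain ⟨M, c, hM, hc, hfail⟩ := failure_bound (C := C) hκ0 hκp hp0 hp1 hσ0 hα
  have hd' : Tendsto (fun n => (d n : ℝ)) atTop atTop := tendsto_natCast_atTop_atTop.comp hd
  filter_upwards [hdB.bound, tendsto_log_sq_natCast.eventually_ge_atTop 2,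
    tendsto_log_sq_natCast.eventually_ge_atTop (C ^ 2 + 2),
    tendsto_log_sq_natCast.eventually_ge_atTop (128 * C ^ 2 / (p / 8) ^ 2 + 1),
    hd'.eventually_ge_atTop 4, hd'.eventually_ge_atTop ((11 / κ) ^ 2),
    hd'.eventually_ge_atTop (2 * M / ε), eventually_sq_mul_exp_le hc (half_pos hε),
    eventually_mul_log_pow_le (B ^ (k + 6)) (2 * (k + 6)), eventually_mul_log_pow_le 4 4,
    eventually_ge_atTop 1] with
    n hn1 hn2 hn3 hn4 hn5 hn6 hn7 hn8 hn9 hn10 hn11 G hG v₀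
  obtain ⟨L, N, H, π, hL, hnNL, hH, hl, hrep⟩ := hG
  obtain ⟨hL1, hL2⟩ := size_bounds hL
  have hn0 : (0 : ℝ) < n := by exact_mod_cast hn11
  set x := Real.log n with hx
  have hdn : (d n : ℝ) ≤ B * x ^ 2 := by
    simpa [abs_of_nonneg (sq_nonneg x)] using hn1
  set D := d n with hD
  have hLx : x ^ 2 / 2 ≤ L := by linarith
  have hLone : 1 ≤ L := by
    have : (1 : ℝ) ≤ L := by linarith
    exact_mod_cast this
  have hDone : 1 ≤ D := by
    have : (1 : ℝ) ≤ D := by linarith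
    exact_mod_cast this
  have hNpos : 0 < N := by
    rcases Nat.eq_zero_or_pos N with h | h
    · rw [h, zero_mul] at hnNL
      omega
    · exact h
  have : Nonempty (Fin N) := ⟨⟨0, hNpos⟩⟩
  have hE : ExpanderData H L D G π C p σ := by
    refine expanderData hrep ?_ hl (by positivity) hDone hLone ?_ (by linarith)
    · intro y
      rw [← hH y]
    · calc (D : ℝ) ≤ B * x ^ 2 := hdn
        _ = 2 * B * (x ^ 2 / 2) := by ring
        _ ≤ 2 * B * L := by gcongr
  set r : ℝ := √(D : ℝ) with hr
  have hrd : r ^ 2 = D := Real.sq_sqrt (by positivity)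
  have hr2 : 2 ≤ r := Real.le_sqrt_of_sq_le (by linarith)
  have hκr : 11 ≤ κ * r := by
    have : 11 / κ ≤ r := Real.le_sqrt_of_sq_le hn6
    rw [div_le_iff₀ hκ0] at this
    linarith
  have hCL : 128 * C ^ 2 ≤ (p / 8) ^ 2 * L := by
    have : 128 * C ^ 2 / (p / 8) ^ 2 ≤ L := by linarith
    rw [div_le_iff₀ (by positivity)] at this
    linarith
  set i : ℕ := ⌊Real.logb r n⌋₊ + 1 with hi
  have hlogb0 : 0 ≤ Real.logb r n := Real.logb_nonneg (by linarith) (by exact_mod_cast hn11)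
  have hni : (n : ℝ) < r ^ i := by
    rw [← Real.rpow_natCast, ← Real.logb_lt_iff_lt_rpow (by linarith) hn0, hi]
    push_cast
    exact Nat.lt_floor_add_one _
  have hNn : (N : ℝ) ≤ n := by
    rw [hnNL]
    exact_mod_cast Nat.le_mul_of_pos_right _ hLone
  have hbound := hE.hitProb_ge_of_seeded (k := k) (α := α) hk hα hr2 hrd hκr hCL i 0
    (by simpa using hNn.trans_lt hni)
    (by simpa using ExpanderData.seeded_initial π (p * L / 8) (κ / 16) v₀)
  have hLN : L ≤ N := by
    have h1 : (L : ℝ) * L ≤ N * L := by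
      calc (L : ℝ) * L ≤ (x ^ 2 + 1) * (x ^ 2 + 1) := by gcongr
        _ ≤ (2 * x ^ 2) * (2 * x ^ 2) := by
          gcongr <;> linarith
        _ = 4 * x ^ 4 := by ring
        _ ≤ n := hn10
        _ = N * L := by exact_mod_cast hnNL
    have h2 : (L : ℝ) ≤ N := le_of_mul_le_mul_right h1 (by exact_mod_cast hLone)
    exact_mod_cast h2
  have hin : i ≤ 2 * n := by
    have h1 : Real.logb r n ≤ n := by
      rw [Real.logb_le_iff_le_rpow (by linarith) hn0, Real.rpow_natCast]
      have h2 : (n : ℝ) ≤ 2 ^ n := by exact_mod_cast (Nat.lt_two_pow_self).le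
      exact h2.trans (by gcongr)
    have h2 : ⌊Real.logb r n⌋₊ ≤ n := Nat.floor_le_of_le h1
    omega
  have hf := hfail (Fin n) (Fin N) L D i hLone hDone (by simpa using hnNL) (by simpa using hLN)
    (by simpa using hin)
  have hMd : M / D ≤ ε / 2 := by
    rw [div_le_iff₀ hε] at hn7
    rw [div_le_iff₀ (by linarith)]
    linarith
  have hexp := hn8 L hL1
  have hT : k + 4 + 2 * i ≤ ⌊5 * Real.logb D n⌋₊ := by
    refine Nat.le_floor ?_
    have hD1 : (1 : ℝ) < D := by linarith
    have h1 : Real.logb r n = 2 * Real.logb D n := by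
      have h2 : Real.log D = 2 * Real.log r := by
        rw [← hrd, Real.log_pow]
        norm_num
      have h3 : Real.log r ≠ 0 := (Real.log_pos (by linarith)).ne'
      unfold Real.logb
      rw [h2]
      field_simp
    have h4 : (⌊Real.logb r n⌋₊ : ℝ) ≤ Real.logb r n := Nat.floor_le hlogb0
    have h5 : ((k + 6 : ℕ) : ℝ) ≤ Real.logb D n := by
      rw [Real.le_logb_iff_rpow_le hD1 hn0, Real.rpow_natCast]
      calc (D : ℝ) ^ (k + 6) ≤ (B * x ^ 2) ^ (k + 6) := by gcongr
        _ = B ^ (k + 6) * x ^ (2 * (k + 6)) := by rw [mul_pow, ← pow_mul]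
        _ ≤ n := hn9
    rw [hi]
    push_cast at h5 ⊢
    linarith
  rw [prob_law_eq]
  refine le_trans ?_ (hitProb_mono (fun c hc b => orangeFractionGE_update hc) hT _)
  refine le_trans ?_ hbound
  simp only [pow_zero, mul_one, Fintype.card_fin] at hf ⊢
  linarith

/-- Part (b): if the degree is constant, the rumor may stay in the first clique. -/
lemma eventually_exp_le_prob_law {C : ℝ} {k : ℕ} {α : ℝ} (hα : 0 < α) (d : ℕ) :
    ∀ᶠ n : ℕ in atTop, ∀ G : SimpleGraph (Fin n), IsModerateExpander C n d G →
      ∀ v₀ : Fin n, ∀ t : ℕ,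
        Real.exp (-(2 * (d + 1) * d)) ≤ prob (law G k v₀ t) (orangeFractionGE α)ᶜ := by
  filter_upwards [eventually_mul_log_pow_le (3 / α) 2,
    tendsto_log_sq_natCast.eventually_ge_atTop 1] with n hn1 hn2 G hG v₀ t
  obtain ⟨L, N, H, π, hL, hnNL, hH, hl, hrep⟩ := hG
  obtain ⟨hL1, hL2⟩ := size_bounds hL
  refine hrep.exp_le_prob_law ?_ v₀ t
  rw [div_mul_eq_mul_div, div_le_iff₀ hα] at hn1
  rw [Fintype.card_fin]
  linarith

end Asymptotics

end RumorSpreading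

end

theorem theorem3 (C : ℝ) (hC : 0 < C) (k : ℕ) (hk : 1 ≤ k)
    (α : ℝ) (hα₀ : 0 < α) (hα₁ : α < 1) :
    -- if `d = ω(1)`, the rumor spreads with high probability within `O(log_d n)` rounds
    (∃ K : ℝ, 0 < K ∧ ∀ d : ℕ → ℕ,
      Filter.Tendsto d Filter.atTop Filter.atTop →
      ((fun n => (d n : ℝ)) =O[Filter.atTop] fun n : ℕ => Real.log n ^ 2) →
      ∀ ε : ℝ, 0 < ε → ∀ᶠ n : ℕ in Filter.atTop,
        ∀ G : SimpleGraph (Fin n), RumorSpreading.IsModerateExpander C n (d n) G →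
        ∀ v₀ : Fin n,
          1 - ε ≤ RumorSpreading.prob
            (RumorSpreading.law G k v₀ ⌊K * Real.logb (d n) n⌋₊)
            (RumorSpreading.orangeFractionGE α)) ∧
    -- for constant `d`, with at least a constant probability the rumor never spreads
    (∀ d : ℕ, ∃ δ : ℝ, 0 < δ ∧ ∀ᶠ n : ℕ in Filter.atTop,
        ∀ G : SimpleGraph (Fin n), RumorSpreading.IsModerateExpander C n d G →
        ∀ v₀ : Fin n, ∀ t : ℕ,
          δ ≤ RumorSpreading.prob (RumorSpreading.law G k v₀ t)
            (RumorSpreading.orangeFractionGE α)ᶜ) :=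
  ⟨⟨5, by norm_num, fun _ hd hdO _ hε =>
      RumorSpreading.eventually_le_prob_law hk hα₁ hd hdO hε⟩,
    fun d => ⟨_, Real.exp_pos _, RumorSpreading.eventually_exp_le_prob_law hα₀ d⟩⟩
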